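/- Let $n\ge 1$, let $\Omega\subset\mathbb{C}^n$ be open (for instance a domain), let $\Delta=\{(\zeta,z)\in\Omega\times\Omega:\zeta=z\}$, and let $\eta(\zeta,z)=2\pi i(z-\zeta)$. Let $E^*=\mathrm{Span}\{d\eta_1,\dots,d\eta_n\}=\mathrm{Span}\{d(z_1-\zeta_1),\dots,d(z_n-\zeta_n)\}$, a subbundle of $T^*_{1,0}(\Omega\times\Omega)$, and for an open set $U\subset\Omega\times\Omega$ put $$\mathcal{L}^m(U)=\bigoplus_p C^\infty\bigl(U,\ \Lambda^pE^*\wedge\Lambda^{p+m}T^*_{0,1}(\Omega\times\Omega)\bigr).$$ Let $\delta_\eta$ be contraction with the vector field $2\pi i\sum_j(\zeta_j-z_j)\,\partial/\partial\zeta_j$, so that $\delta_\eta\, d(z_j-\zeta_j)=\eta_j$ and $\delta_\eta$ annihilates $T^*_{0,1}$, and let $\nabla_\eta=\delta_\eta-\bar\partial$, where $\bar\partial$ is taken in both variables $\zeta$ and $z$. Both operators are extended to currents on $\Omega\times\Omega$ by duality (with a form $F$ acting by $\varphi\mapsto\int F\wedge\varphi$). Let $[\Delta]$ be the current of integration over $\Delta$.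 Suppose that $u=u_1+\dots+u_n\in\mathcal{L}^{-1}(\Omega\times\Omega\setminus\Delta)$, where $u_k$ takes values in $\Lambda^kE^*\wedge\Lambda^{k-1}T^*_{0,1}$, satisfies $\nabla_\eta u=1$ on $\Omega\times\Omega\setminus\Delta$, and that for $1\le k\le n$ we have $|u_k|\lesssim|\eta|^{-(2k-1)}$, in the sense that for every compact $K\subset\Omega\times\Omega$ there is a constant $C$ with $|u_k|\le C|\eta|^{-(2k-1)}$ on $K\setminus\Delta$. Then $u$ is locally integrable on $\Omega\times\Omega$ and, in the sense of currents on $\Omega\times\Omega$, $$\nabla_\eta u=1-[\Delta].$$ -/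

import Mathlib

open MeasureTheory TopologicalSpace
open scoped ContDiff Distributions

namespace Koppelman

noncomputable section

/-- Points `(ζ, z)` of `ℂⁿ × ℂⁿ`. -/
abbrev Pt (n : ℕ) : Type := (Fin n → ℂ) × (Fin n → ℂ)

/-- The complexified cotangent space of `ℂⁿ × ℂⁿ`: real-linear maps to `ℂ`. -/
abbrev Covec (n : ℕ) : Type := Pt n →ₗ[ℝ] ℂ

/-- The exterior algebra of the complexified cotangent space. A differential form on a subset of
`ℂⁿ × ℂⁿ` is a function with values in `Forms n`; the wedge product is the multiplication. -/
def Forms (n : ℕ) : Type := ExteriorAlgebra ℂ (Covec n)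

instance (n : ℕ) : Ring (Forms n) := inferInstanceAs (Ring (ExteriorAlgebra ℂ (Covec n)))

instance (n : ℕ) : Algebra ℂ (Forms n) :=
  inferInstanceAs (Algebra ℂ (ExteriorAlgebra ℂ (Covec n)))

/-- A covector as a form of degree one. -/
def oneForm (n : ℕ) : Covec n →ₗ[ℂ] Forms n := ExteriorAlgebra.ι ℂ

instance (n : ℕ) : Module.Finite ℂ (Covec n) := Module.Finite.of_restrictScalars_finite ℝ ℂ _

instance (n : ℕ) : Module.Finite ℂ (Forms n) :=
  Module.Finite.of_basis (Module.finBasis ℂ (Covec n)).ExteriorAlgebra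

/-! ### The norm on the fibre

The fibre is a finite-dimensional complex vector space, so all its norms are equivalent; we take
the largest coefficient in some fixed basis. -/

/-- Coefficients in a fixed basis of the fibre. -/
def coeffs (n : ℕ) : Forms n ≃ₗ[ℂ] (Fin (Module.finrank ℂ (Forms n)) → ℂ) :=
  (Module.finBasis ℂ (Forms n)).equivFun

instance (n : ℕ) : NormedAddCommGroup (Forms n) :=
  NormedAddCommGroup.induced _ _ (coeffs n) (coeffs n).injective

instance (n : ℕ) : NormedSpace ℂ (Forms n) := NormedSpace.induced ℂ _ _ (coeffs n)

/-! ### Coordinates, differentials and vector fields -/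

/-- The coordinate vector of `ζ_j`. -/
def vecζ {n : ℕ} (j : Fin n) : Pt n := (Pi.single j 1, 0)

/-- The coordinate vector of `z_j`. -/
def vecz {n : ℕ} (j : Fin n) : Pt n := (0, Pi.single j 1)

/-- The coordinate function `ζ_j`, which is also the covector `dζ_j`. -/
def dζ {n : ℕ} (j : Fin n) : Covec n :=
  (LinearMap.proj j : (Fin n → ℂ) →ₗ[ℝ] ℂ) ∘ₗ LinearMap.fst ℝ _ _

/-- The covector `dz_j`. -/
def dz {n : ℕ} (j : Fin n) : Covec n :=
  (LinearMap.proj j : (Fin n → ℂ) →ₗ[ℝ] ℂ) ∘ₗ LinearMap.snd ℝ _ _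

/-- The covector `dζ̄_j`. -/
def dζbar {n : ℕ} (j : Fin n) : Covec n := Complex.conjLIE.toLinearMap ∘ₗ dζ j

/-- The covector `dz̄_j`. -/
def dzbar {n : ℕ} (j : Fin n) : Covec n := Complex.conjLIE.toLinearMap ∘ₗ dz j

/-- The vector-valued function `η(ζ, z) = 2πi (z - ζ)`. -/
def eta {n : ℕ} (x : Pt n) : Fin n → ℂ := fun j => 2 * Real.pi * Complex.I * (x.2 j - x.1 j)

/-- The Euclidean length `|η|`. -/
def absEta {n : ℕ} (x : Pt n) : ℝ := Real.sqrt (∑ j, ‖eta x j‖ ^ 2)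

/-- The diagonal `Δ = {ζ = z}`. -/
def diagonal (n : ℕ) : Set (Pt n) := {x | x.1 = x.2}

/-- The fibre of `E* = span {dη_1, …, dη_n} = span {d(z_1 - ζ_1), …, d(z_n - ζ_n)}`. -/
def Estar (n : ℕ) : Submodule ℂ (Covec n) := Submodule.span ℂ (Set.range fun j => dz j - dζ j)

/-- The fibre of the bundle `T*_{0,1}` of `(0,1)`-covectors on `ℂⁿ × ℂⁿ`. -/
def T01 (n : ℕ) : Submodule ℂ (Covec n) :=
  Submodule.span ℂ (Set.range dζbar ∪ Set.range dzbar)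

/-- The fibre of `Λ^p E* ∧ Λ^q T*_{0,1}`; it is zero for negative `q`. -/
def bidegree (n : ℕ) (p : ℕ) (q : ℤ) : Submodule ℂ (ExteriorAlgebra ℂ (Covec n)) :=
  if 0 ≤ q then
    ((Estar n).map (ExteriorAlgebra.ι ℂ)) ^ p * ((T01 n).map (ExteriorAlgebra.ι ℂ)) ^ q.toNat
  else ⊥

/-- An element of `𝓛^m(U) = ⨁_p C^∞(U, Λ^p E* ∧ Λ^{p+m} T*_{0,1})`, given by its components. -/
structure LSection (n : ℕ) (m : ℤ) (U : Set (Pt n)) where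
  /-- The component with values in `Λ^p E* ∧ Λ^{p+m} T*_{0,1}`. -/
  comp : ℕ → Pt n → Forms n
  smooth : ∀ p, ContDiffOn ℝ ∞ (comp p) U
  mem : ∀ p, ∀ x ∈ U, (comp p x : ExteriorAlgebra ℂ (Covec n)) ∈ bidegree n p (p + m)

/-- The sum of the components (`Λ^p E* = 0` for `p > n`). -/
def LSection.toForm {n : ℕ} {m : ℤ} {U : Set (Pt n)} (u : LSection n m U) : Pt n → Forms n :=
  fun x => ∑ p ∈ Finset.range (n + 1), u.comp p x

/-- The derivation `∂F/∂w̄` in the complex direction `v`: `(D_v F + i D_{iv} F) / 2`. -/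
def wirtingerBar {n : ℕ} (v : Pt n) (F : Pt n → Forms n) (x : Pt n) : Forms n :=
  (1 / 2 : ℂ) • (fderiv ℝ F x v + Complex.I • fderiv ℝ F x (Complex.I • v))

/-- The operator `∂̄` on forms on `ℂⁿ × ℂⁿ`, in all the variables `ζ` and `z`. -/
def dbar {n : ℕ} (F : Pt n → Forms n) (x : Pt n) : Forms n :=
  ∑ j, (oneForm n (dζbar j) * wirtingerBar (vecζ j) F x +
    oneForm n (dzbar j) * wirtingerBar (vecz j) F x)

/-- The tangent vector `e_j = -∂/∂ζ_j` of type `(1,0)`, as a functional on covectors. It satisfies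
`⟨e_j, d(z_k - ζ_k)⟩ = δ_{jk}` and it annihilates `T*_{0,1}`. -/
def eVec {n : ℕ} (j : Fin n) : Module.Dual ℂ (Covec n) where
  toFun m := -((1 / 2 : ℂ) * (m (vecζ j) - Complex.I * m (Complex.I • vecζ j)))
  map_add' a b := by simp only [LinearMap.add_apply]; ring
  map_smul' c a := by simp only [LinearMap.smul_apply, smul_eq_mul, RingHom.id_apply]; ring

/-- Contraction (interior multiplication) of forms with the vector `∑ j, w j • e_j`. -/
def contractVec (n : ℕ) : (Fin n → ℂ) →ₗ[ℂ] Forms n →ₗ[ℂ] Forms n :=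
  (CliffordAlgebra.contractLeft (Q := (0 : QuadraticForm ℂ (Covec n)))) ∘ₗ
    (Fintype.linearCombination ℂ (eVec (n := n)))

/-- `δ_η`: contraction with `∑ j, η_j e_j = 2πi ∑ j, (ζ_j - z_j) ∂/∂ζ_j`, so that
`δ_η d(z_j - ζ_j) = η_j`. -/
def deltaEta {n : ℕ} (F : Pt n → Forms n) (x : Pt n) : Forms n := contractVec n (eta x) (F x)

/-- The operator `∇_η = δ_η - ∂̄` on forms. -/
def nablaEta {n : ℕ} (F : Pt n → Forms n) (x : Pt n) : Forms n := deltaEta F x - dbar F x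

/-! ### Evaluation of forms and integration -/

/-- Evaluation of the degree `k` part of a form on `k` tangent vectors; on `m_1 ∧ … ∧ m_k` it is
`det (m_i (v_j))`. -/
def evalForm {n k : ℕ} (v : Fin k → Pt n) : Forms n →ₗ[ℂ] ℂ :=
  ExteriorAlgebra.liftAlternating (Pi.single k
    ((Matrix.detRowAlternating (R := ℂ) (n := Fin k)).compLinearMap
      { toFun := fun m j => m (v j)
        map_add' := fun _ _ => rfl
        map_smul' := fun _ _ => rfl }))

/-- The real frame `b_1, i b_1, …, b_m, i b_m`, in the order given by the complex orientation. -/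
def realFrame {n m : ℕ} (b : Fin m → Pt n) : Fin (m * 2) → Pt n := fun i =>
  ![b (finProdFinEquiv.symm i).1, Complex.I • b (finProdFinEquiv.symm i).1]
    (finProdFinEquiv.symm i).2

/-- The coefficient of a form with respect to the Lebesgue volume form of `ℂⁿ × ℂⁿ`. -/
def topCoeff (n : ℕ) : Forms n →ₗ[ℂ] ℂ := evalForm (realFrame (Fin.append vecζ vecz))

/-- The coefficient of the pull-back of a form under `w ↦ (w, w)` with respect to the Lebesgue
volume form of `ℂⁿ`. -/
def diagCoeff (n : ℕ) : Forms n →ₗ[ℂ] ℂ := evalForm (realFrame fun j => vecζ j + vecz j)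

/-! ### Currents -/

/-- Currents on an open set `X ⊆ ℂⁿ × ℂⁿ`: continuous linear functionals on smooth compactly
supported forms (of all degrees). -/
abbrev Current {n : ℕ} (X : Opens (Pt n)) : Type := 𝓓(X, Forms n) →L[ℂ] ℂ

/-- The pairing `(φ, F) ↦ topCoeff (F ∧ φ)`. -/
def wedgePairing (n : ℕ) : Forms n →L[ℂ] Forms n →L[ℂ] ℂ :=
  ((LinearMap.mul ℂ (Forms n)).flip.compr₂ (topCoeff n)).toContinuousBilinearMap

/-- The current `φ ↦ ∫ F ∧ φ` of a locally integrable form `F` (and zero for other `F`). -/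
def Current.ofForm {n : ℕ} (X : Opens (Pt n)) (F : Pt n → Forms n) : Current X :=
  TestFunction.integralAgainstBilinCLM (wedgePairing n) volume F

theorem Current.ofForm_apply {n : ℕ} {X : Opens (Pt n)} {F : Pt n → Forms n}
    (hF : LocallyIntegrableOn F X) (φ : 𝓓(X, Forms n)) :
    Current.ofForm X F φ = ∫ x, topCoeff n (F x * φ x) :=
  TestFunction.integralAgainstBilinCLM_eq_integral hF

/-- The open set `Ω × Ω`. -/
def square {n : ℕ} (Ω : Opens (Fin n → ℂ)) : Opens (Pt n) :=
  ⟨(Ω : Set (Fin n → ℂ)) ×ˢ (Ω : Set (Fin n → ℂ)), Ω.isOpen.prod Ω.isOpen⟩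

/-- The pairing of the current of integration over the diagonal of `Ω × Ω` is integration with
respect to this measure on `ℂⁿ × ℂⁿ`. -/
def diagMeasure (n : ℕ) : Measure (Pt n) := (volume : Measure (Fin n → ℂ)).map fun w => (w, w)

/-- The current `[Δ]` of integration over the diagonal of `Ω × Ω`. -/
def Current.diagonal {n : ℕ} (Ω : Opens (Fin n → ℂ)) : Current (square Ω) :=
  TestFunction.integralAgainstBilinCLM
    ((LinearMap.mul ℂ ℂ).comp (diagCoeff n)).toContinuousBilinearMap (diagMeasure n) fun _ => 1

/-- `⟨[Δ], φ⟩` is the integral over `w ∈ Ω` of the pull-back of `φ` under `w ↦ (w, w)`. -/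
theorem Current.diagonal_apply {n : ℕ} (Ω : Opens (Fin n → ℂ)) (φ : 𝓓(square Ω, Forms n)) :
    Current.diagonal Ω φ = ∫ w in (Ω : Set (Fin n → ℂ)), diagCoeff n (φ (w, w)) := by
  have hc : Topology.IsClosedEmbedding fun w : Fin n → ℂ => (w, w) :=
    Function.LeftInverse.isClosedEmbedding (f := Prod.fst) (fun _ => rfl) continuous_fst
      (by fun_prop)
  have hloc : LocallyIntegrableOn (fun _ : Pt n => (1 : ℂ)) (square Ω) (diagMeasure n) := by
    refine LocallyIntegrable.locallyIntegrableOn ?_ _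
    intro x
    obtain ⟨K, hK, hx⟩ := exists_compact_mem_nhds x
    refine ⟨K, hx, ?_⟩
    refine integrableOn_const ?_
    rw [diagMeasure, hc.measurableEmbedding.map_apply]
    exact (hc.isCompact_preimage hK).measure_ne_top
  rw [Current.diagonal, TestFunction.integralAgainstBilinCLM_eq_integral hloc, diagMeasure,
    hc.measurableEmbedding.integral_map, setIntegral_eq_integral_of_forall_compl_eq_zero]
  · simp
  · intro w hw
    have : φ (w, w) = 0 := by
      by_contra h
      exact hw (φ.tsupport_subset (subset_tsupport _ h)).1
    simp [this]

/-- The operator `φ ↦ ∂̄φ` on test forms. -/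
def dbarTest {n : ℕ} (X : Opens (Pt n)) : 𝓓(X, Forms n) →L[ℂ] 𝓓(X, Forms n) :=
  let D (v : Pt n) : 𝓓(X, Forms n) →L[ℂ] 𝓓(X, Forms n) := TestFunction.lineDerivCLM ℂ v
  let L (c : ℂ) (m : Covec n) : 𝓓(X, Forms n) →L[ℂ] 𝓓(X, Forms n) :=
    TestFunction.postcompCLM
      (LinearMap.toContinuousLinearMap (c • LinearMap.mulLeft ℂ (oneForm n m)))
  ∑ j, (L (1 / 2) (dζbar j) ∘L D (vecζ j) +
    L (1 / 2 * Complex.I) (dζbar j) ∘L D (Complex.I • vecζ j) +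
    (L (1 / 2) (dzbar j) ∘L D (vecz j) +
    L (1 / 2 * Complex.I) (dzbar j) ∘L D (Complex.I • vecz j)))

theorem dbarTest_apply {n : ℕ} (X : Opens (Pt n)) (φ : 𝓓(X, Forms n)) (x : Pt n) :
    dbarTest X φ x = dbar φ x := by
  simp [dbarTest, dbar, wirtingerBar, mul_add, mul_smul,
    (φ.contDiff.differentiable (by simp) x).lineDeriv_eq_fderiv]

theorem contDiff_eta {n : ℕ} : ContDiff ℝ ∞ (eta (n := n)) := by
  unfold eta
  fun_prop

theorem support_deltaEta {n : ℕ} (F : Pt n → Forms n) :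
    Function.support (deltaEta F) ⊆ Function.support F := by
  intro x hx h
  exact hx (by simp [deltaEta, h])

theorem contDiff_deltaEta {n : ℕ} {F : Pt n → Forms n} (hF : ContDiff ℝ ∞ F) :
    ContDiff ℝ ∞ (deltaEta F) := by
  have h : deltaEta F = fun x => ∑ j, eta x j • (LinearMap.toContinuousLinearMap
      (contractVec n (Pi.single j 1))).restrictScalars ℝ (F x) := by
    funext x
    have hx : eta x = ∑ j, eta x j • (Pi.single j 1 : Fin n → ℂ) := by
      ext k
      simp [Finset.sum_apply, Pi.single_apply]
    have h2 : contractVec n (eta x) = ∑ j, eta x j • contractVec n (Pi.single j 1) := by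
      conv_lhs => rw [hx]
      simp only [map_sum, map_smul]
    simp [deltaEta, h2, LinearMap.sum_apply]
  rw [h]
  refine ContDiff.sum fun j _ => ContDiff.fun_smul ?_ ?_
  · exact contDiff_pi.1 contDiff_eta j
  · exact (ContinuousLinearMap.contDiff _).comp hF

/-- The operator `φ ↦ δ_η φ` on test forms. -/
def deltaTest {n : ℕ} (X : Opens (Pt n)) : 𝓓(X, Forms n) →L[ℂ] 𝓓(X, Forms n) :=
  TestFunction.limitCLM ℂ
    (fun φ => ⟨deltaEta φ,
      contDiff_deltaEta φ.contDiff,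
      φ.hasCompactSupport.mono' ((support_deltaEta φ).trans (subset_tsupport _)),
      (closure_mono (support_deltaEta φ)).trans φ.tsupport_subset⟩)
    (fun _ hK => TestFunction.ofSupportedInCLM ℂ hK ∘L
      ContDiffMapSupportedIn.bilinLeftCLM
        (contractVec n).flip.toContinuousBilinearMap contDiff_eta)
    (fun _ _ _ => rfl)

theorem deltaTest_apply {n : ℕ} (X : Opens (Pt n)) (φ : 𝓓(X, Forms n)) (x : Pt n) :
    deltaTest X φ x = deltaEta φ x := rfl

/-- The operator `φ ↦ (-1)^{deg φ} φ` on test forms. -/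
def signTest {n : ℕ} (X : Opens (Pt n)) : 𝓓(X, Forms n) →L[ℂ] 𝓓(X, Forms n) :=
  TestFunction.postcompCLM (LinearMap.toContinuousLinearMap
    (CliffordAlgebra.involute (Q := (0 : QuadraticForm ℂ (Covec n)))).toLinearMap)

/-- `∂̄T` for a current `T`: `⟨∂̄T, φ⟩ = (-1)^{deg T + 1} ⟨T, ∂̄φ⟩`, where the sign is
`(-1)^{deg φ}` because only the part of `T` with `deg T + deg φ + 1 = 4n` contributes. -/
def Current.dbar {n : ℕ} {X : Opens (Pt n)} (T : Current X) : Current X :=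
  T ∘L dbarTest X ∘L signTest X

/-- `δ_η T` for a current `T`: `⟨δ_η T, φ⟩ = (-1)^{deg T + 1} ⟨T, δ_η φ⟩`, where the sign is
`(-1)^{deg φ}` because only the part of `T` with `deg T + deg φ - 1 = 4n` contributes. -/
def Current.deltaEta {n : ℕ} {X : Opens (Pt n)} (T : Current X) : Current X :=
  T ∘L deltaTest X ∘L signTest X

/-- `∇_η T = δ_η T - ∂̄T` for a current `T`. -/
def Current.nablaEta {n : ℕ} {X : Opens (Pt n)} (T : Current X) : Current X :=
  T.deltaEta - T.dbar

end

end Koppelman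

/-!
Write `w = z - ζ` and `θ_j = dw̄_j ∧ dw_j`. The current equation is obtained by multiplying `u` with
a smooth weight that removes its singularity. For a smooth cutoff `χ` on the line,
equal to `1` on `s ≤ 1` and to `0` on `s ≥ 2`, the weight with parameter `c` is
`g_c = ∏_j (χ(c²|w_j|²) + (i / 2π) c² χ'(c²|w_j|²) θ_j)`.
Each factor is `∇_η`-closed and even, hence so is `g_c` (`weight_closed`), and `g_c = 1` near the
diagonal. So for a test form `φ` the form `u ∧ (1 - g_c) ∧ φ` is smooth with compact support, and
since `∇_η` is an antiderivation, `∇_η u = 1` and `u` is odd, Stokes' theorem gives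
`∫ u ∧ (1 - g_c) ∧ ∇_η φ = ∫ (1 - g_c) ∧ φ` (`integral_toForm_mul_one_sub_weight`).

Now let `c → ∞`. Expand `g_c = ∑_J (coefficient) θ_J` over sets of indices. The coefficient of `θ_J`
is `O(|w|^{-2|J|})` uniformly in `c`, and off the diagonal it vanishes for large `c`.
* In `u_p ∧ θ_J` the degree in `E*` is `p + |J|`, so the product vanishes if `p + |J| > n`. Otherwise
  it is `O(|w|^{-(2n-1)})`, which is integrable because the diagonal has real codimension `2n`.
  Hence `∫ u ∧ g_c ∧ ∇_η φ → 0` by dominated convergence (`tendsto_integral_toForm_mul_weight`).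
* In `∫ g_c ∧ φ` the terms with `|J| < n` disappear for the same reason. The coefficient of
  `θ_1 ⋯ θ_n` is a multiple of an approximate identity in `w`, and the top coefficient of
  `θ_1 ⋯ θ_n ∧ φ` is a multiple of the coefficient of `φ` on the diagonal
  (`topCoeff_prod_theta_mul`). So `∫ g_c ∧ φ → ∫_Δ φ` (`tendsto_integral_weight`).

Together `∫ u ∧ ∇_η φ = ∫ φ - ∫_Δ φ`. The signs in the action of `∇_η` on currents are absorbed by
applying this to `(-1)^{deg φ} φ`, which has the same components in the even degrees `2n` and `4n`.
-/

namespace Koppelman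

noncomputable section

/-! ### Exterior algebra -/

section Exterior

variable {R M N : Type*} [CommRing R] [AddCommGroup M] [Module R M] [AddCommGroup N] [Module R N]

/-- Contraction is an antiderivation. -/
theorem contractLeft_mul {Q : QuadraticForm R M} (d : Module.Dual R M) (a b : CliffordAlgebra Q) :
    CliffordAlgebra.contractLeft d (a * b) =
      CliffordAlgebra.contractLeft d a * b +
        CliffordAlgebra.involute a * CliffordAlgebra.contractLeft d b := by
  induction a using CliffordAlgebra.left_induction with
  | algebraMap r => simp [CliffordAlgebra.contractLeft_algebraMap_mul]
  | add x y hx hy => simp only [add_mul, map_add, hx, hy]; abel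
  | ι_mul x m hx =>
    simp only [mul_assoc, CliffordAlgebra.contractLeft_ι_mul, hx, map_mul,
      CliffordAlgebra.involute_ι, sub_mul, mul_add, smul_mul_assoc, neg_mul]
    abel

theorem ι_mul_eq_involute_mul_ι (m : M) (a : ExteriorAlgebra R M) :
    ExteriorAlgebra.ι R m * a =
      CliffordAlgebra.involute (Q := (0 : QuadraticForm R M)) a * ExteriorAlgebra.ι R m := by
  induction a using CliffordAlgebra.left_induction with
  | algebraMap r => rw [AlgHom.commutes]; exact (Algebra.commutes r _).symm
  | add x y hx hy => rw [mul_add, hx, hy, map_add, add_mul]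
  | ι_mul x m' hx =>
    rw [map_mul, CliffordAlgebra.involute_ι, mul_assoc, ← hx, ← mul_assoc, ← mul_assoc, neg_mul,
      ← eq_neg_of_add_eq_zero_left (ExteriorAlgebra.ι_add_mul_swap m m')]

theorem involute_of_mem_pow {k : ℕ} {x : ExteriorAlgebra R M}
    (hx : x ∈ LinearMap.range (ExteriorAlgebra.ι R (M := M)) ^ k) :
    CliffordAlgebra.involute (Q := (0 : QuadraticForm R M)) x = (-1 : R) ^ k • x := by
  induction hx using Submodule.pow_induction_on_left' with
  | algebraMap r => rw [AlgHom.commutes]; simp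
  | add x y i hx hy h1 h2 => rw [map_add, h1, h2, smul_add]
  | mem_mul m hm i x hx h =>
    obtain ⟨m, rfl⟩ := hm
    rw [map_mul, h, show CliffordAlgebra.involute (ExteriorAlgebra.ι R m) = -ExteriorAlgebra.ι R m
      from CliffordAlgebra.involute_ι m, pow_succ]
    simp

/-- A functional built from alternating maps of a single degree `k` kills the other degrees. -/
theorem liftAlternating_single_ιMulti_of_ne {k r : ℕ} (h : r ≠ k) (f : M [⋀^Fin k]→ₗ[R] N)
    (m : Fin r → M) :
    ExteriorAlgebra.liftAlternating (Pi.single k f) (ExteriorAlgebra.ιMulti R r m) = 0 := by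
  rw [ExteriorAlgebra.liftAlternating_apply_ιMulti, Pi.single_eq_of_ne h]
  rfl

theorem liftAlternating_single_of_mem_pow {k r : ℕ} (h : r ≠ k) (f : M [⋀^Fin k]→ₗ[R] N)
    {x : ExteriorAlgebra R M} (hx : x ∈ LinearMap.range (ExteriorAlgebra.ι R (M := M)) ^ r) :
    ExteriorAlgebra.liftAlternating (Pi.single k f) x = 0 := by
  change x ∈ ⋀[R]^r M at hx
  rw [← ExteriorAlgebra.ιMulti_span_fixedDegree] at hx
  induction hx using Submodule.span_induction with
  | mem x hx => obtain ⟨m, rfl⟩ := hx; exact liftAlternating_single_ιMulti_of_ne h f m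
  | zero => exact map_zero _
  | add x y _ _ hx hy => rw [map_add, hx, hy, add_zero]
  | smul c x _ hx => rw [map_smul, hx, smul_zero]

/-- Contraction lowers the degree by one; the truncated subtraction is harmless because scalars are
annihilated, which is recorded separately. -/
theorem contractLeft_mem_pow (d : Module.Dual R M) {k : ℕ} {x : ExteriorAlgebra R M}
    (hx : x ∈ LinearMap.range (ExteriorAlgebra.ι R (M := M)) ^ k) :
    CliffordAlgebra.contractLeft (Q := (0 : QuadraticForm R M)) d x ∈
      LinearMap.range (ExteriorAlgebra.ι R (M := M)) ^ (k - 1) ∧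
    (k = 0 → CliffordAlgebra.contractLeft (Q := (0 : QuadraticForm R M)) d x = 0) := by
  induction hx using Submodule.pow_induction_on_left' with
  | algebraMap r =>
    have h := CliffordAlgebra.contractLeft_algebraMap (Q := (0 : QuadraticForm R M)) d r
    refine ⟨?_, fun _ => h⟩
    erw [h]
    exact Submodule.zero_mem _
  | add x y i hx hy h1 h2 =>
    erw [map_add]
    exact ⟨Submodule.add_mem _ h1.1 h2.1, fun h => by rw [h1.2 h, h2.2 h, add_zero]⟩
  | mem_mul m hm i x hx h =>
    obtain ⟨m, rfl⟩ := hm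
    refine ⟨?_, fun h => absurd h (Nat.succ_ne_zero i)⟩
    erw [CliffordAlgebra.contractLeft_ι_mul]
    refine Submodule.sub_mem _ (Submodule.smul_mem _ _ hx) ?_
    rcases i with _ | i
    · rw [h.2 rfl, mul_zero]
      exact Submodule.zero_mem _
    · rw [Nat.succ_sub_one, pow_succ']
      exact Submodule.mul_mem_mul ⟨m, rfl⟩ h.1

/-- Linear maps on the exterior algebra are determined by the products of vectors. -/
theorem linearMap_ext_ιMulti {f g : ExteriorAlgebra R M →ₗ[R] N}
    (h : ∀ r (m : Fin r → M), f (ExteriorAlgebra.ιMulti R r m) = g (ExteriorAlgebra.ιMulti R r m))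
    (x : ExteriorAlgebra R M) : f x = g x := by
  have : f = g := ExteriorAlgebra.lhom_ext fun r => AlternatingMap.ext (h r)
  rw [this]

/-- A functional of top degree kills every contraction: before contraction, the form would have
to be of degree larger than the dimension. -/
theorem liftAlternating_single_contractLeft {K V W : Type*} [Field K] [AddCommGroup V] [Module K V]
    [AddCommGroup W] [Module K W] [Module.Finite K V] {k : ℕ} (hk : Module.finrank K V ≤ k)
    (f : V [⋀^Fin k]→ₗ[K] W) (d : Module.Dual K V) (x : ExteriorAlgebra K V) :
    ExteriorAlgebra.liftAlternating (Pi.single k f)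
      (CliffordAlgebra.contractLeft (Q := (0 : QuadraticForm K V)) d x) = 0 := by
  refine linearMap_ext_ιMulti
    (f := ExteriorAlgebra.liftAlternating (Pi.single k f) ∘ₗ
      (CliffordAlgebra.contractLeft (Q := (0 : QuadraticForm K V)) d)) (g := 0) ?_ x
  intro r m
  have hmem : ExteriorAlgebra.ιMulti K r m ∈ LinearMap.range (ExteriorAlgebra.ι K (M := V)) ^ r :=
    ExteriorAlgebra.ιMulti_range K r ⟨m, rfl⟩
  -- only degree `k + 1` could contribute, and it is larger than the dimension
  by_cases hr : r = k + 1
  · subst hr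
    have h0 : ExteriorAlgebra.ιMulti K (k + 1) m = 0 := by
      refine AlternatingMap.map_linearDependent _ _ fun hli => ?_
      have := hli.fintype_card_le_finrank
      rw [Fintype.card_fin] at this
      omega
    rw [h0, map_zero, map_zero]
  · have := contractLeft_mem_pow d hmem
    rcases r with _ | r
    · rw [LinearMap.comp_apply]
      erw [this.2 rfl]
      simp
    · exact liftAlternating_single_of_mem_pow (by omega) f this.1

theorem liftAlternating_single_involute {k : ℕ} (hk : Even k) (f : M [⋀^Fin k]→ₗ[R] N)
    (x : ExteriorAlgebra R M) :
    ExteriorAlgebra.liftAlternating (Pi.single k f)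
      (CliffordAlgebra.involute (Q := (0 : QuadraticForm R M)) x) =
    ExteriorAlgebra.liftAlternating (Pi.single k f) x := by
  refine linearMap_ext_ιMulti
    (f := ExteriorAlgebra.liftAlternating (Pi.single k f) ∘ₗ
      (CliffordAlgebra.involute (Q := (0 : QuadraticForm R M))).toLinearMap) ?_ x
  intro r m
  have hmem : ExteriorAlgebra.ιMulti R r m ∈ LinearMap.range (ExteriorAlgebra.ι R (M := M)) ^ r :=
    ExteriorAlgebra.ιMulti_range R r ⟨m, rfl⟩
  rw [LinearMap.comp_apply, AlgHom.toLinearMap_apply]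
  erw [involute_of_mem_pow hmem]
  rw [map_smul]
  by_cases hr : r = k
  · subst hr; rw [hk.neg_one_pow, one_smul]
  · rw [liftAlternating_single_ιMulti_of_ne hr, smul_zero]

theorem commute_map_ι (P Q : Submodule R M) :
    Commute (P.map (ExteriorAlgebra.ι R)) (Q.map (ExteriorAlgebra.ι R)) := by
  have key : ∀ P Q : Submodule R M, P.map (ExteriorAlgebra.ι R) * Q.map (ExteriorAlgebra.ι R) ≤
      Q.map (ExteriorAlgebra.ι R) * P.map (ExteriorAlgebra.ι R) := by
    intro P Q
    rw [Submodule.mul_le]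
    rintro _ ⟨a, ha, rfl⟩ _ ⟨b, hb, rfl⟩
    rw [eq_neg_of_add_eq_zero_left (ExteriorAlgebra.ι_add_mul_swap a b)]
    exact Submodule.neg_mem _ (Submodule.mul_mem_mul ⟨b, hb, rfl⟩ ⟨a, ha, rfl⟩)
  exact le_antisymm (key P Q) (key Q P)

/-- The exterior power of degree `n + 1` of the span of `n` vectors vanishes. -/
theorem map_ι_span_pow_eq_bot {n : ℕ} (b : Fin n → M) :
    ((Submodule.span R (Set.range b)).map (ExteriorAlgebra.ι R)) ^ (n + 1) = ⊥ := by
  rw [Submodule.map_span, Submodule.span_pow, Submodule.span_eq_bot]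
  intro x hx
  obtain ⟨l, hl⟩ := Set.mem_pow.1 hx
  choose m hm hm' using fun i => (l i).2
  choose j hj using hm
  have : x = ExteriorAlgebra.ιMulti R (n + 1) fun i => b (j i) := by
    rw [ExteriorAlgebra.ιMulti_apply, ← hl]
    congr 2
    funext i
    rw [hj, hm']
  rw [this]
  refine ExteriorAlgebra.ιMulti_eq_zero_of_not_inj fun hinj => ?_
  have : Function.Injective j := fun a c h => hinj (by simp [h])
  simpa using Fintype.card_le_of_injective j this

end Exterior

/-! ### The form `∏ dw̄_j ∧ dw_j` restricts the top coefficient to the diagonal -/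

/-- The covector `dw_j`, where `w = z - ζ`. -/
def dw {n : ℕ} (j : Fin n) : Covec n := dz j - dζ j

/-- The covector `dw̄_j`, where `w = z - ζ`. -/
def dwbar {n : ℕ} (j : Fin n) : Covec n := dzbar j - dζbar j

/-- The form `dw̄_j ∧ dw_j`, where `w = z - ζ`. -/
def theta {n : ℕ} (j : Fin n) : Forms n := oneForm n (dwbar j) * oneForm n (dw j)

/-- The product of `m_1, …, m_k`, as a form. -/
def wedgeList {n k : ℕ} (m : Fin k → Covec n) : Forms n := ExteriorAlgebra.ιMulti ℂ k m

theorem wedgeList_eq_prod {n k : ℕ} (m : Fin k → Covec n) :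
    wedgeList m = (List.ofFn fun i => oneForm n (m i)).prod :=
  ExteriorAlgebra.ιMulti_apply m

theorem wedgeList_mul {n k l : ℕ} (a : Fin k → Covec n) (b : Fin l → Covec n) :
    wedgeList a * wedgeList b = wedgeList (Fin.append a b) :=
  ExteriorAlgebra.ιMulti_mul_ιMulti a b

theorem evalForm_wedgeList {n k : ℕ} (v : Fin k → Pt n) (m : Fin k → Covec n) :
    evalForm v (wedgeList m) = (Matrix.of fun i j => m i (v j)).det :=
  ExteriorAlgebra.liftAlternating_apply_ιMulti _ _ |>.trans (by rw [Pi.single_eq_same]; rfl)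

theorem evalForm_wedgeList_of_ne {n k r : ℕ} (h : r ≠ k) (v : Fin k → Pt n) (m : Fin r → Covec n) :
    evalForm v (wedgeList m) = 0 :=
  liftAlternating_single_ιMulti_of_ne h _ m

/-- The covectors `dw̄_1, dw_1, …, dw̄_n, dw_n`. -/
def wRow (n : ℕ) : Fin (n * 2) → Covec n := fun i =>
  ![dwbar (finProdFinEquiv.symm i).1, dw (finProdFinEquiv.symm i).1] (finProdFinEquiv.symm i).2

theorem prod_theta (n : ℕ) : (List.ofFn (theta (n := n))).prod = wedgeList (wRow n) := by
  rw [wedgeList_eq_prod, List.ofFn_mul, List.prod_flatten, List.map_ofFn]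
  congr 2
  funext j
  have h (k : Fin 2) : finProdFinEquiv.symm (⟨j * 2 + k, by omega⟩ : Fin (n * 2)) = (j, k) := by
    rw [Equiv.symm_apply_eq]
    ext
    simp [finProdFinEquiv, add_comm, mul_comm]
  simp only [Function.comp_apply, wRow]
  simp [h, theta]

/-- The real frame of a concatenation of complex frames is the concatenation of the real frames. -/
theorem realFrame_append {n : ℕ} (a b : Fin n → Pt n) (i : Fin (n * 2 + n * 2)) :
    realFrame (Fin.append a b) (Fin.cast (by omega) i) =
      Fin.append (realFrame a) (realFrame b) i := by
  have key (m : ℕ) (c : Fin m → Pt n) (p : Fin (m * 2)) (q : Fin m) (r : Fin 2)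
      (h : (p : ℕ) = q * 2 + r) : realFrame c p = ![c q, Complex.I • c q] r := by
    have : finProdFinEquiv.symm p = (q, r) := by
      rw [Equiv.symm_apply_eq]
      ext
      simp [finProdFinEquiv, h, add_comm, mul_comm]
    rw [realFrame, this]
  refine Fin.addCases (fun i => ?_) (fun i => ?_) i
  · obtain ⟨⟨q, r⟩, rfl⟩ := finProdFinEquiv.surjective i
    rw [Fin.append_left, key n a _ q r (by simp [finProdFinEquiv, add_comm, mul_comm]),
      key (n + n) _ _ (Fin.castAdd n q) r (by simp [finProdFinEquiv, add_comm, mul_comm]),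
      Fin.append_left]
  · obtain ⟨⟨q, r⟩, rfl⟩ := finProdFinEquiv.surjective i
    rw [Fin.append_right, key n b _ q r (by simp [finProdFinEquiv, add_comm, mul_comm]),
      key (n + n) _ _ (Fin.natAdd n q) r (by simp [finProdFinEquiv]; ring),
      Fin.append_right]

theorem realFrame_add {n : ℕ} (i : Fin (n * 2)) :
    realFrame (fun j : Fin n => vecζ j + vecz j) i =
      realFrame (vecζ (n := n)) i + realFrame (vecz (n := n)) i := by
  unfold realFrame
  generalize (finProdFinEquiv.symm i).2 = k
  fin_cases k <;> simp [smul_add]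

/-- The covectors `dw̄_j`, `dw_j` see only the difference `z - ζ`. -/
theorem wRow_realFrame_vecζ {n : ℕ} (i j : Fin (n * 2)) :
    wRow n i (realFrame vecζ j) = -wRow n i (realFrame vecz j) := by
  unfold realFrame wRow
  generalize finProdFinEquiv.symm i = p
  generalize finProdFinEquiv.symm j = q
  obtain ⟨p, k⟩ := p
  obtain ⟨q, l⟩ := q
  fin_cases k <;> fin_cases l <;> simp [dw, dwbar, dzbar, dζbar, dz, dζ, vecz, vecζ]

theorem det_wRow_realFrame_vecz (n : ℕ) :
    (Matrix.of fun i j => wRow n i (realFrame vecz j)).det = (2 * Complex.I) ^ n := by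
  rw [← Matrix.det_submatrix_equiv_self (finProdFinEquiv (m := n) (n := 2))]
  have : (Matrix.of fun i j => wRow n i (realFrame vecz j)).submatrix
      (finProdFinEquiv (m := n) (n := 2)) finProdFinEquiv =
      (Matrix.blockDiagonal fun _ : Fin n => !![1, -Complex.I; 1, Complex.I]).submatrix
        (Equiv.prodComm _ _) (Equiv.prodComm _ _) := by
    ext ⟨p, k⟩ ⟨q, l⟩
    simp only [Matrix.submatrix_apply, Matrix.of_apply, wRow, realFrame, Equiv.symm_apply_apply,
      Equiv.prodComm_apply, Prod.swap, Matrix.blockDiagonal_apply]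
    by_cases hpq : p = q
    · subst hpq
      fin_cases k <;> fin_cases l <;> simp [dw, dwbar, dzbar, dζbar, dz, dζ, vecz]
    · fin_cases k <;> fin_cases l <;>
        simp [dw, dwbar, dzbar, dζbar, dz, dζ, vecz, hpq]
  rw [this, Matrix.det_submatrix_equiv_self, Matrix.det_blockDiagonal]
  simp [Matrix.det_fin_two_of, two_mul]

/-- Wedging with `∏ dw̄_j ∧ dw_j` turns the top coefficient into the coefficient on the diagonal:
a column operation makes the matrix of values on the frame block triangular. -/
theorem topCoeff_prod_theta_mul (n : ℕ) (a : Forms n) :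
    topCoeff n ((List.ofFn (theta (n := n))).prod * a) = (2 * Complex.I) ^ n * diagCoeff n a := by
  rw [prod_theta]
  refine linearMap_ext_ιMulti
    (f := topCoeff n ∘ₗ LinearMap.mulLeft ℂ (wedgeList (wRow n)))
    (g := (2 * Complex.I) ^ n • diagCoeff n) (fun r m => ?_) a
  change topCoeff n (wedgeList (wRow n) * wedgeList m) =
    (2 * Complex.I) ^ n * diagCoeff n (wedgeList m)
  rw [wedgeList_mul, topCoeff, diagCoeff]
  by_cases hr : r = n * 2
  swap
  · rw [evalForm_wedgeList_of_ne hr, evalForm_wedgeList_of_ne (by omega), mul_zero]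
  subst hr
  have hcast {k l : ℕ} (h : k = l) (v : Fin l → Pt n) (m : Fin k → Covec n) :
      evalForm v (wedgeList m) = (Matrix.of fun i j => m i (v (Fin.cast h j))).det := by
    subst h
    exact evalForm_wedgeList v m
  rw [evalForm_wedgeList, hcast (by omega)]
  simp only [realFrame_append]
  rw [← Matrix.det_submatrix_equiv_self finSumFinEquiv]
  -- the rows are `dw̄_j, dw_j` and then `m`; the columns are the `ζ`-frame and then the `z`-frame
  set W := Matrix.of fun i j => wRow n i (realFrame vecz j) with hW
  set A := Matrix.of fun i j => m i (realFrame vecζ j)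
  set B := Matrix.of fun i j => m i (realFrame vecz j)
  have hblock : (Matrix.of fun i j => Fin.append (wRow n) m i
      (Fin.append (realFrame vecζ) (realFrame vecz) j)).submatrix
        (finSumFinEquiv (m := n * 2) (n := n * 2)) finSumFinEquiv =
      Matrix.fromBlocks (-W) W A B := by
    ext (i | i) (j | j) <;>
      simp only [Matrix.submatrix_apply, Matrix.of_apply, finSumFinEquiv_apply_left,
        finSumFinEquiv_apply_right, Fin.append_left, Fin.append_right, Matrix.fromBlocks_apply₁₁,
        Matrix.fromBlocks_apply₁₂, Matrix.fromBlocks_apply₂₁, Matrix.fromBlocks_apply₂₂,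
        Matrix.neg_apply, wRow_realFrame_vecζ, W, A, B]
  -- adding the `ζ`-columns to the `z`-columns evaluates the second half on the diagonal frame
  have hmul : Matrix.fromBlocks (-W) W A B *
      Matrix.fromBlocks 1 1 0 (1 : Matrix (Fin (n * 2)) (Fin (n * 2)) ℂ) =
      Matrix.fromBlocks (-W) 0 A (A + B) := by
    simp [Matrix.fromBlocks_multiply]
  have hdet := congrArg Matrix.det hmul
  rw [Matrix.det_mul, Matrix.det_fromBlocks_zero₂₁, Matrix.det_one, Matrix.det_fromBlocks_zero₁₂,
    mul_one, mul_one] at hdet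
  rw [hblock, hdet, Matrix.det_neg, hW, det_wRow_realFrame_vecz, Fintype.card_fin, pow_mul']
  simp only [even_two, Even.neg_pow, one_pow, one_mul]
  congr 2
  ext i j
  simp [A, B, realFrame_add]

/-! ### Degrees in `E*` and `T*_{0,1}` -/

/-- The image of `E*` in the exterior algebra. -/
abbrev EForms (n : ℕ) : Submodule ℂ (ExteriorAlgebra ℂ (Covec n)) :=
  (Estar n).map (ExteriorAlgebra.ι ℂ)

/-- The image of `T*_{0,1}` in the exterior algebra. -/
abbrev TForms (n : ℕ) : Submodule ℂ (ExteriorAlgebra ℂ (Covec n)) :=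
  (T01 n).map (ExteriorAlgebra.ι ℂ)

theorem EForms_pow_eq_bot {n p : ℕ} (hp : n < p) : EForms n ^ p = ⊥ := by
  obtain ⟨k, rfl⟩ := Nat.exists_eq_add_of_lt hp
  rw [show n + k + 1 = (n + 1) + k by omega, pow_add, EForms, Estar, map_ι_span_pow_eq_bot,
    Submodule.bot_mul]

theorem dwbar_mem_T01 {n : ℕ} (j : Fin n) : dwbar j ∈ T01 n :=
  Submodule.sub_mem _ (Submodule.subset_span (Or.inr ⟨j, rfl⟩))
    (Submodule.subset_span (Or.inl ⟨j, rfl⟩))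

theorem theta_mem {n : ℕ} (j : Fin n) :
    (theta j : ExteriorAlgebra ℂ (Covec n)) ∈ EForms n * TForms n := by
  rw [(commute_map_ι _ _).eq]
  exact Submodule.mul_mem_mul (A := ExteriorAlgebra ℂ (Covec n)) ⟨_, dwbar_mem_T01 j, rfl⟩ ⟨_, Submodule.subset_span ⟨j, rfl⟩, rfl⟩

theorem oneForm_mul_swap {n : ℕ} (a b : Covec n) :
    oneForm n a * oneForm n b = -(oneForm n b * oneForm n a) :=
  eq_neg_of_add_eq_zero_left (ExteriorAlgebra.ι_add_mul_swap a b)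

theorem oneForm_mul_self {n : ℕ} (a : Covec n) : oneForm n a * oneForm n a = 0 :=
  ExteriorAlgebra.ι_sq_zero a

theorem theta_comm {n : ℕ} (i j : Fin n) : theta i * theta j = theta j * theta i := by
  have h (a b c : Covec n) : oneForm n a * (oneForm n b * oneForm n c) =
      oneForm n b * oneForm n c * oneForm n a := by
    rw [← mul_assoc, oneForm_mul_swap a b, neg_mul, mul_assoc, oneForm_mul_swap a c, mul_neg,
      neg_neg, mul_assoc]
  unfold theta
  rw [mul_assoc, h, ← mul_assoc, h]
  simp only [mul_assoc]

open scoped IsMulCommutative in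
/-- Commuting elements of a noncommutative algebra can be substituted into polynomials. -/
theorem exists_algHom_of_commute {R A ι : Type*} [CommRing R] [Ring A] [Algebra R A] (t : ι → A)
    (ht : ∀ i j, t i * t j = t j * t i) :
    ∃ Θ : MvPolynomial ι R →ₐ[R] A, ∀ j, Θ (MvPolynomial.X j) = t j := by
  have := Algebra.isMulCommutative_adjoin R (s := Set.range t) (by
    rintro _ ⟨i, rfl⟩ _ ⟨j, rfl⟩
    exact ht i j)
  let s : ι → Algebra.adjoin R (Set.range t) := fun j => ⟨t j, Algebra.subset_adjoin ⟨j, rfl⟩⟩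
  refine ⟨(Algebra.adjoin R (Set.range t)).val.comp (MvPolynomial.aeval s), fun j => ?_⟩
  rw [AlgHom.comp_apply, MvPolynomial.aeval_X]
  rfl

/-- Substitution of the commuting forms `θ_j = dw̄_j ∧ dw_j` into polynomials. -/
def thetaHom (n : ℕ) : MvPolynomial (Fin n) ℂ →ₐ[ℂ] Forms n :=
  (exists_algHom_of_commute theta theta_comm).choose

theorem thetaHom_X {n : ℕ} (j : Fin n) : thetaHom n (MvPolynomial.X j) = theta j :=
  (exists_algHom_of_commute theta theta_comm).choose_spec j

/-- The product of the `θ_j` over `j ∈ J`. -/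
def thetaProd {n : ℕ} (J : Finset (Fin n)) : Forms n := thetaHom n (∏ j ∈ J, MvPolynomial.X j)

theorem thetaProd_univ (n : ℕ) :
    thetaProd (Finset.univ : Finset (Fin n)) = (List.ofFn (theta (n := n))).prod := by
  rw [thetaProd, ← List.prod_ofFn, map_list_prod, List.map_ofFn]
  congr 2
  funext j
  exact thetaHom_X j

theorem thetaProd_mem {n : ℕ} (J : Finset (Fin n)) :
    (thetaProd J : ExteriorAlgebra ℂ (Covec n)) ∈ EForms n ^ J.card * TForms n ^ J.card := by
  rw [← (commute_map_ι _ _).mul_pow]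
  induction J using Finset.induction_on with
  | empty =>
    rw [thetaProd, Finset.prod_empty, map_one, Finset.card_empty, pow_zero]
    exact Submodule.one_le.1 (le_refl (1 : Submodule ℂ (ExteriorAlgebra ℂ (Covec n))))
  | insert j J hj ih =>
    rw [thetaProd, Finset.prod_insert hj, map_mul, thetaHom_X, Finset.card_insert_of_notMem hj,
      pow_succ']
    exact Submodule.mul_mem_mul (A := ExteriorAlgebra ℂ (Covec n)) (theta_mem j) ih

/-- A form of degree `p` in `E*` is killed by `θ_J` when `p + |J| > n`. -/
theorem mul_thetaProd_eq_zero {n p : ℕ} {q : ℤ} {J : Finset (Fin n)} (h : n < p + J.card)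
    {a : Forms n} (ha : (a : ExteriorAlgebra ℂ (Covec n)) ∈ bidegree n p q) :
    a * thetaProd J = 0 := by
  unfold bidegree at ha
  split_ifs at ha
  · have h1 := Submodule.mul_mem_mul (A := ExteriorAlgebra ℂ (Covec n)) ha (thetaProd_mem J)
    rw [((commute_map_ι (T01 n) (Estar n)).pow_pow _ _).mul_mul_mul_comm, ← pow_add,
      EForms_pow_eq_bot h, Submodule.bot_mul] at h1
    exact (Submodule.mem_bot (M := ExteriorAlgebra ℂ (Covec n)) ℂ).1 h1
  · rw [(Submodule.mem_bot (M := ExteriorAlgebra ℂ (Covec n)) ℂ).1 ha]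
    exact zero_mul (thetaProd J)

/-- The sign automorphism `a ↦ (-1)^{deg a} a`. -/
def signHom (n : ℕ) : Forms n →ₐ[ℂ] Forms n :=
  CliffordAlgebra.involute (Q := (0 : QuadraticForm ℂ (Covec n)))

theorem signHom_oneForm {n : ℕ} (m : Covec n) : signHom n (oneForm n m) = -oneForm n m :=
  CliffordAlgebra.involute_ι m

theorem oneForm_mul {n : ℕ} (m : Covec n) (a : Forms n) :
    oneForm n m * a = signHom n a * oneForm n m :=
  ι_mul_eq_involute_mul_ι m a

theorem signHom_theta {n : ℕ} (j : Fin n) : signHom n (theta j) = theta j := by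
  simp [theta, signHom_oneForm]

/-- The components of a section of `𝓛^{-1}` have odd degree `p + (p - 1)`. -/
theorem signHom_of_mem_bidegree {n p : ℕ} {a : Forms n}
    (ha : (a : ExteriorAlgebra ℂ (Covec n)) ∈ bidegree n p (p + (-1))) : signHom n a = -a := by
  unfold bidegree at ha
  split_ifs at ha with h
  · have hle (P : Submodule ℂ (Covec n)) : P.map (ExteriorAlgebra.ι ℂ) ≤
        LinearMap.range (ExteriorAlgebra.ι ℂ) := LinearMap.map_le_range
    have := mul_le_mul' (pow_le_pow_left' (hle (Estar n)) p)
      (pow_le_pow_left' (hle (T01 n)) _) ha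
    rw [← pow_add] at this
    have h2 := involute_of_mem_pow this
    rw [Odd.neg_one_pow ⟨p - 1, by omega⟩] at h2
    exact h2.trans (neg_one_smul ℂ a)
  · rw [(Submodule.mem_bot (M := ExteriorAlgebra ℂ (Covec n)) ℂ).1 ha]
    exact (map_zero (signHom n)).trans neg_zero.symm

/-- The sign automorphism is the identity in the top degree `4n`. -/
theorem topCoeff_signHom {n : ℕ} (a : Forms n) : topCoeff n (signHom n a) = topCoeff n a :=
  liftAlternating_single_involute (by simp) _ a

/-- The sign automorphism is the identity in the degree `2n` of the diagonal. -/
theorem diagCoeff_signHom {n : ℕ} (a : Forms n) : diagCoeff n (signHom n a) = diagCoeff n a :=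
  liftAlternating_single_involute (by simp) _ a

theorem finrank_Covec (n : ℕ) : Module.finrank ℂ (Covec n) = (n + n) * 2 := by
  have h1 : Module.finrank ℝ (Covec n) = Module.finrank ℝ (Pt n) * Module.finrank ℝ ℂ :=
    Module.finrank_linearMap ℝ ℝ _ _
  have h2 : Module.finrank ℝ (Pt n) = (n + n) * 2 := by
    rw [Module.finrank_prod, Module.finrank_pi_fintype]
    simp
    ring
  have h3 := Module.finrank_mul_finrank ℝ ℂ (Covec n)
  rw [h1, h2, Complex.finrank_real_complex] at h3
  omega

/-- A contraction has no component of top degree, so `δ_η` does not contribute to Stokes' theorem. -/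
theorem topCoeff_contractVec {n : ℕ} (w : Fin n → ℂ) (a : Forms n) :
    topCoeff n (contractVec n w a) = 0 :=
  liftAlternating_single_contractLeft (finrank_Covec n).le _ _ a

theorem contractVec_mul {n : ℕ} (w : Fin n → ℂ) (a b : Forms n) :
    contractVec n w (a * b) = contractVec n w a * b + signHom n a * contractVec n w b :=
  contractLeft_mul _ a b

theorem contractVec_oneForm {n : ℕ} (w : Fin n → ℂ) (m : Covec n) :
    contractVec n w (oneForm n m) = algebraMap ℂ (Forms n) (∑ j, w j * eVec j m) := by
  refine (CliffordAlgebra.contractLeft_ι (Q := (0 : QuadraticForm ℂ (Covec n)))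
    (Fintype.linearCombination ℂ (eVec (n := n)) w) m).trans ?_
  simp [Fintype.linearCombination_apply]
  rfl

theorem eVec_dw {n : ℕ} (i j : Fin n) : eVec i (dw j) = if i = j then 1 else 0 := by
  rcases eq_or_ne i j with rfl | h
  · simp [eVec, dw, dz, dζ, vecζ]
    norm_num
  · simp [eVec, dw, dz, dζ, vecζ, h]

theorem eVec_dwbar {n : ℕ} (i j : Fin n) : eVec i (dwbar j) = 0 := by
  rcases eq_or_ne i j with rfl | h
  · simp [eVec, dwbar, dzbar, dζbar, dz, dζ, vecζ]
  · simp [eVec, dwbar, dzbar, dζbar, dz, dζ, vecζ, h]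

theorem contractVec_theta {n : ℕ} (w : Fin n → ℂ) (j : Fin n) :
    contractVec n w (theta j) = -(w j • oneForm n (dwbar j)) := by
  rw [theta, contractVec_mul, contractVec_oneForm, contractVec_oneForm, signHom_oneForm]
  simp [eVec_dw, eVec_dwbar, ← Algebra.commutes, ← Algebra.smul_def]

theorem contractVec_algebraMap {n : ℕ} (w : Fin n → ℂ) (c : ℂ) :
    contractVec n w (algebraMap ℂ (Forms n) c) = 0 :=
  CliffordAlgebra.contractLeft_algebraMap (Q := (0 : QuadraticForm ℂ (Covec n))) _ c

/-! ### Product rules for `∂̄` and `∇_η` -/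

instance (n : ℕ) : FiniteDimensional ℝ (Forms n) :=
  Module.Finite.trans ℂ (Forms n)

/-- Multiplication of forms as a continuous bilinear map over `ℝ`. -/
def mulCLM (n : ℕ) : Forms n →L[ℝ] Forms n →L[ℝ] Forms n :=
  ((LinearMap.mul ℂ (Forms n)).toContinuousBilinearMap).bilinearRestrictScalars ℝ

theorem mulCLM_apply {n : ℕ} (a b : Forms n) : mulCLM n a b = a * b := rfl

theorem fderiv_form_mul {n : ℕ} {F G : Pt n → Forms n} {x : Pt n} (hF : DifferentiableAt ℝ F x)
    (hG : DifferentiableAt ℝ G x) (v : Pt n) :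
    fderiv ℝ (fun y => F y * G y) x v = F x * fderiv ℝ G x v + fderiv ℝ F x v * G x := by
  have h := (mulCLM n).fderiv_of_bilinear hF hG
  simp only [mulCLM_apply] at h
  rw [h]
  simp [mulCLM_apply]

theorem _root_.ContDiffAt.form_mul {n : ℕ} {F G : Pt n → Forms n} {x : Pt n}
    (hF : ContDiffAt ℝ ∞ F x) (hG : ContDiffAt ℝ ∞ G x) :
    ContDiffAt ℝ ∞ (fun y => F y * G y) x :=
  ((mulCLM n).isBoundedBilinearMap.contDiff.contDiffAt).comp x (hF.prodMk hG)

theorem _root_.ContDiff.form_mul {n : ℕ} {F G : Pt n → Forms n} (hF : ContDiff ℝ ∞ F)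
    (hG : ContDiff ℝ ∞ G) : ContDiff ℝ ∞ (fun y => F y * G y) :=
  contDiff_iff_contDiffAt.2 fun _ => hF.contDiffAt.form_mul hG.contDiffAt

theorem wirtingerBar_mul {n : ℕ} {F G : Pt n → Forms n} {x : Pt n} (hF : DifferentiableAt ℝ F x)
    (hG : DifferentiableAt ℝ G x) (v : Pt n) :
    wirtingerBar v (fun y => F y * G y) x =
      F x * wirtingerBar v G x + wirtingerBar v F x * G x := by
  simp only [wirtingerBar, fderiv_form_mul hF hG, smul_add, mul_add, add_mul, mul_smul_comm,
    smul_mul_assoc]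
  abel

theorem dbar_mul {n : ℕ} {F G : Pt n → Forms n} {x : Pt n} (hF : DifferentiableAt ℝ F x)
    (hG : DifferentiableAt ℝ G x) :
    dbar (fun y => F y * G y) x = dbar F x * G x + signHom n (F x) * dbar G x := by
  have h (m : Covec n) (a b : Forms n) (v : Pt n) :
      oneForm n m * (F x * a + wirtingerBar v F x * b) =
        oneForm n m * wirtingerBar v F x * b + signHom n (F x) * (oneForm n m * a) := by
    rw [mul_add, ← mul_assoc, oneForm_mul, mul_assoc, ← mul_assoc (oneForm n m), add_comm]
  simp only [dbar, wirtingerBar_mul hF hG, h, Finset.sum_mul, Finset.mul_sum, add_mul, mul_add,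
    Finset.sum_add_distrib]
  abel

/-- `∇_η` is an antiderivation. -/
theorem nablaEta_mul {n : ℕ} {F G : Pt n → Forms n} {x : Pt n} (hF : DifferentiableAt ℝ F x)
    (hG : DifferentiableAt ℝ G x) :
    nablaEta (fun y => F y * G y) x =
      nablaEta F x * G x + signHom n (F x) * nablaEta G x := by
  rw [nablaEta, dbar_mul hF hG, deltaEta, contractVec_mul, nablaEta, nablaEta, deltaEta, deltaEta,
    sub_mul, mul_sub]
  abel

theorem nablaEta_congr {n : ℕ} {F G : Pt n → Forms n} {x : Pt n} (h : F =ᶠ[nhds x] G) :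
    nablaEta F x = nablaEta G x := by
  simp only [nablaEta, deltaEta, dbar, wirtingerBar, h.fderiv_eq, h.eq_of_nhds]

theorem nablaEta_sub {n : ℕ} {F G : Pt n → Forms n} {x : Pt n} (hF : DifferentiableAt ℝ F x)
    (hG : DifferentiableAt ℝ G x) :
    nablaEta (fun y => F y - G y) x = nablaEta F x - nablaEta G x := by
  simp only [nablaEta, deltaEta, dbar, wirtingerBar, fderiv_fun_sub hF hG, map_sub,
    sub_apply, smul_sub, smul_add, mul_sub, mul_add, Finset.sum_sub_distrib,
    Finset.sum_add_distrib]
  abel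

theorem nablaEta_const_one {n : ℕ} (x : Pt n) : nablaEta (fun _ : Pt n => (1 : Forms n)) x = 0 := by
  have h := contractVec_algebraMap (eta x) 1
  rw [map_one] at h
  simp [nablaEta, deltaEta, dbar, wirtingerBar, h]

instance (n : ℕ) : (volume : Measure (Pt n)).IsAddHaarMeasure :=
  Measure.prod.instIsAddHaarMeasure _ _

/-- Stokes' theorem for `∇_η`: the integral of `∇_η F` vanishes when `F` has compact support. -/
theorem integral_topCoeff_nablaEta {n : ℕ} {F : Pt n → Forms n} (hF : ContDiff ℝ ∞ F)
    (hc : HasCompactSupport F) : ∫ x, topCoeff n (nablaEta F x) = 0 := by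
  have hcd (v : Pt n) : Continuous fun x => fderiv ℝ F x v :=
    (hF.continuous_fderiv (by simp)).clm_apply continuous_const
  have hcs (v : Pt n) : HasCompactSupport fun x => fderiv ℝ F x v :=
    (hc.fderiv ℝ).mono' fun x hx => subset_tsupport _ fun h => hx (by simp [h])
  have hint (v : Pt n) : Integrable fun x => fderiv ℝ F x v :=
    (hcd v).integrable_of_hasCompactSupport (hcs v)
  have hzero (v : Pt n) : ∫ x, fderiv ℝ F x v = 0 := by
    have := integral_smul_fderiv_eq_neg_fderiv_smul_of_integrable (μ := (volume : Measure (Pt n)))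
      (f := fun _ => (1 : ℝ)) (g := F) (v := v) (by simp) (by simpa using hint v)
      (by simpa using hF.continuous.integrable_of_hasCompactSupport hc)
      (fun x _ => by fun_prop) (fun x _ => hF.differentiable (by simp) x)
    simpa using this
  have hL (m : Covec n) (c : ℂ) (v : Pt n) :
      Integrable (fun x => topCoeff n (oneForm n m * (c • fderiv ℝ F x v))) ∧
        ∫ x, topCoeff n (oneForm n m * (c • fderiv ℝ F x v)) = 0 := by
    let ℓ : Forms n →L[ℂ] ℂ := LinearMap.toContinuousLinearMap
      (topCoeff n ∘ₗ LinearMap.mulLeft ℂ (oneForm n m) ∘ₗ (c • LinearMap.id))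
    refine ⟨ℓ.integrable_comp (hint v), (ℓ.integral_comp_comm (hint v)).trans ?_⟩
    rw [hzero, map_zero]
  have hW (m : Covec n) (v : Pt n) :
      Integrable (fun x => topCoeff n (oneForm n m * wirtingerBar v F x)) ∧
        ∫ x, topCoeff n (oneForm n m * wirtingerBar v F x) = 0 := by
    simp only [wirtingerBar, smul_add, mul_add, map_add, smul_smul]
    refine ⟨(hL _ _ _).1.add (hL _ _ _).1, ?_⟩
    rw [integral_add (hL _ _ _).1 (hL _ _ _).1, (hL _ _ _).2, (hL _ _ _).2, add_zero]
  simp only [nablaEta, deltaEta, map_sub, topCoeff_contractVec, zero_sub, dbar, map_sum, map_add]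
  rw [integral_neg, integral_finsetSum]
  · simp only [integral_add (hW _ _).1 (hW _ _).1, (hW _ _).2]
    simp
  · exact fun j _ => (hW _ _).1.add (hW _ _).1

/-! ### The `∇_η`-closed weight -/

/-- A smooth function on the line which is `1` for `s ≤ 1` and `0` for `s ≥ 2`. -/
def cutoff (s : ℝ) : ℝ := Real.smoothTransition (2 - s)

theorem contDiff_cutoff : ContDiff ℝ ∞ cutoff :=
  Real.smoothTransition.contDiff.comp (contDiff_const.sub contDiff_id)

theorem cutoff_of_le_one {s : ℝ} (h : s ≤ 1) : cutoff s = 1 :=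
  Real.smoothTransition.one_of_one_le (by linarith)

theorem cutoff_of_two_le {s : ℝ} (h : 2 ≤ s) : cutoff s = 0 :=
  Real.smoothTransition.zero_of_nonpos (by linarith)

theorem antitone_cutoff : Antitone cutoff := fun _ _ h =>
  Real.smoothTransition.monotone (by linarith)

theorem contDiff_deriv_cutoff : ContDiff ℝ ∞ (deriv cutoff) :=
  (contDiff_infty_iff_deriv.1 contDiff_cutoff).2

theorem deriv_cutoff_of_lt_one {s : ℝ} (h : s < 1) : deriv cutoff s = 0 := by
  have : cutoff =ᶠ[nhds s] fun _ => 1 := by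
    filter_upwards [eventually_lt_nhds h] with t ht using cutoff_of_le_one ht.le
  rw [this.deriv_eq, deriv_const]

theorem deriv_cutoff_of_two_lt {s : ℝ} (h : 2 < s) : deriv cutoff s = 0 := by
  have : cutoff =ᶠ[nhds s] fun _ => 0 := by
    filter_upwards [eventually_gt_nhds h] with t ht using cutoff_of_two_le ht.le
  rw [this.deriv_eq, deriv_const]

/-- The function `|w_j|²`, where `w = z - ζ`. -/
def sqW {n : ℕ} (j : Fin n) (x : Pt n) : ℝ := Complex.normSq (x.2 j - x.1 j)

theorem contDiff_sqW {n : ℕ} (j : Fin n) : ContDiff ℝ ∞ (sqW j) := by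
  unfold sqW
  simp only [Complex.normSq_eq_norm_sq]
  refine ContDiff.norm_sq ℝ ?_
  fun_prop

theorem fderiv_sqW {n : ℕ} (j : Fin n) (x v : Pt n) :
    fderiv ℝ (sqW j) x v = 2 * ((x.2 j - x.1 j).re * (v.2 j - v.1 j).re +
      (x.2 j - x.1 j).im * (v.2 j - v.1 j).im) := by
  have hD := (((ContinuousLinearMap.proj j : (Fin n → ℂ) →L[ℝ] ℂ).comp (.snd ℝ _ (Fin n → ℂ))) -
    ((ContinuousLinearMap.proj j : (Fin n → ℂ) →L[ℝ] ℂ).comp (.fst ℝ _ _))).hasFDerivAt (x := x)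
  change HasFDerivAt (fun y : Pt n => y.2 j - y.1 j) _ x at hD
  have hre := Complex.reCLM.hasFDerivAt.comp x hD
  have him := Complex.imCLM.hasFDerivAt.comp x hD
  have h := (hre.mul hre).add (him.mul him)
  have h2 : HasFDerivAt (sqW j) _ x := h
  rw [h2.fderiv]
  simp
  ring

/-- `∂̄ φ(|w_j|²) = φ'(|w_j|²) w_j dw̄_j`. -/
theorem dbar_radial_smul {n : ℕ} (j : Fin n) {φ : ℝ → ℝ} (hφ : Differentiable ℝ φ) (a : Forms n)
    (x : Pt n) :
    dbar (fun y => (φ (sqW j y) : ℂ) • a) x =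
      (((deriv φ (sqW j x) : ℝ) : ℂ) * (x.2 j - x.1 j)) • (oneForm n (dwbar j) * a) := by
  have hder (v : Pt n) : fderiv ℝ (fun y => (φ (sqW j y) : ℂ) • a) x v =
      ((deriv φ (sqW j x) * fderiv ℝ (sqW j) x v : ℝ) : ℂ) • a := by
    have h1 : HasFDerivAt (fun y => φ (sqW j y)) _ x :=
      (hφ (sqW j x)).hasDerivAt.comp_hasFDerivAt x
        ((contDiff_sqW j).differentiable (by simp) x).hasFDerivAt
    have h2 : HasFDerivAt (fun y => (φ (sqW j y) : ℂ) • a) _ x :=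
      ((Complex.ofRealCLM.hasFDerivAt.comp x h1).smul_const a)
    rw [h2.fderiv]
    simp
  have hw (v : Pt n) : wirtingerBar v (fun y => (φ (sqW j y) : ℂ) • a) x =
      (((deriv φ (sqW j x) : ℝ) : ℂ) * (x.2 j - x.1 j) * (starRingEnd ℂ) (v.2 j - v.1 j)) • a := by
    rw [wirtingerBar, hder, hder, smul_smul, ← add_smul, smul_smul]
    congr 1
    simp only [fderiv_sqW]
    apply Complex.ext <;> simp <;> ring
  simp only [dbar, hw]
  rw [Finset.sum_eq_single j]
  · simp [vecζ, vecz, dwbar, sub_mul, smul_sub]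
    abel
  · intro k _ hk
    simp [vecζ, vecz, hk.symm]
  · simp

/-- The scalar part of a factor of the weight. -/
def coefA {n : ℕ} (c : ℝ) (j : Fin n) (x : Pt n) : ℝ := cutoff (c ^ 2 * sqW j x)

/-- The real function `c² χ'(c² |w_j|²)`, where `χ` is the cutoff. -/
def coefB {n : ℕ} (c : ℝ) (j : Fin n) (x : Pt n) : ℝ := c ^ 2 * deriv cutoff (c ^ 2 * sqW j x)

/-- The factor `χ(c²|w_j|²) + (i / 2π) c² χ'(c²|w_j|²) dw̄_j ∧ dw_j` of the weight. -/
def weightFactor {n : ℕ} (c : ℝ) (j : Fin n) (x : Pt n) : Forms n :=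
  (coefA c j x : ℂ) • 1 + (coefB c j x : ℂ) • ((Complex.I / (2 * Real.pi)) • theta j)

theorem contDiff_coefA {n : ℕ} (c : ℝ) (j : Fin n) : ContDiff ℝ ∞ (coefA c j) :=
  contDiff_cutoff.comp (contDiff_const.mul (contDiff_sqW j))

theorem contDiff_coefB {n : ℕ} (c : ℝ) (j : Fin n) : ContDiff ℝ ∞ (coefB c j) :=
  contDiff_const.mul (contDiff_deriv_cutoff.comp (contDiff_const.mul (contDiff_sqW j)))

theorem contDiff_ofReal_smul {n : ℕ} {h : Pt n → ℝ} (hh : ContDiff ℝ ∞ h) (a : Forms n) :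
    ContDiff ℝ ∞ fun x => (h x : ℂ) • a :=
  (Complex.ofRealCLM.contDiff.comp hh).fun_smul contDiff_const

theorem contDiff_weightFactor {n : ℕ} (c : ℝ) (j : Fin n) : ContDiff ℝ ∞ (weightFactor c j) :=
  (contDiff_ofReal_smul (contDiff_coefA c j) _).add (contDiff_ofReal_smul (contDiff_coefB c j) _)

theorem signHom_weightFactor {n : ℕ} (c : ℝ) (j : Fin n) (x : Pt n) :
    signHom n (weightFactor c j x) = weightFactor c j x := by
  rw [weightFactor, map_add, map_smul, map_smul, map_smul, map_one, signHom_theta]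

theorem dbar_add {n : ℕ} {F G : Pt n → Forms n} {x : Pt n} (hF : DifferentiableAt ℝ F x)
    (hG : DifferentiableAt ℝ G x) : dbar (fun y => F y + G y) x = dbar F x + dbar G x := by
  simp only [dbar, wirtingerBar, fderiv_fun_add hF hG, add_apply, smul_add,
    mul_add, Finset.sum_add_distrib]
  abel

/-- The factors of the weight are `∇_η`-closed: the contraction of the `θ_j`-term cancels `∂̄` of the
scalar term, and `∂̄` of the `θ_j`-term contains `dw̄_j ∧ dw̄_j`. -/
theorem nablaEta_weightFactor {n : ℕ} (c : ℝ) (j : Fin n) (x : Pt n) :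
    nablaEta (weightFactor c j) x = 0 := by
  have h1 := dbar_radial_smul j (φ := fun s => cutoff (c ^ 2 * s))
    ((contDiff_cutoff.differentiable (by simp)).comp (by fun_prop)) 1 x
  have h2 := dbar_radial_smul j (φ := fun s => c ^ 2 * deriv cutoff (c ^ 2 * s))
    (((contDiff_deriv_cutoff.differentiable (by simp)).comp (by fun_prop)).const_mul _)
    ((Complex.I / (2 * Real.pi)) • theta j) x
  have h3 : deriv (fun s => cutoff (c ^ 2 * s)) (sqW j x) = coefB c j x := by
    have := ((contDiff_cutoff.differentiable (by simp)) (c ^ 2 * sqW j x)).hasDerivAt.comp (sqW j x)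
      ((hasDerivAt_id (sqW j x)).const_mul (c ^ 2))
    refine this.deriv.trans ?_
    rw [coefB, mul_one, mul_comm]
  have h4 : oneForm n (dwbar j) * theta j = 0 := by
    rw [theta, ← mul_assoc, oneForm_mul_self, zero_mul]
  rw [mul_smul_comm, h4, smul_zero, smul_zero] at h2
  rw [h3, mul_one] at h1
  have hd : dbar (weightFactor c j) x =
      ((coefB c j x : ℂ) * (x.2 j - x.1 j)) • oneForm n (dwbar j) := by
    refine (dbar_add (F := fun y => (coefA c j y : ℂ) • 1)
      (G := fun y => (coefB c j y : ℂ) • ((Complex.I / (2 * Real.pi)) • theta j)) ?_ ?_).trans ?_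
    · exact (contDiff_ofReal_smul (contDiff_coefA c j) _).differentiable (by simp) x
    · exact (contDiff_ofReal_smul (contDiff_coefB c j) _).differentiable (by simp) x
    · refine (congrArg₂ (· + ·) h1 h2).trans (add_zero _)
  have h5 := contractVec_algebraMap (eta x) 1
  rw [map_one] at h5
  rw [nablaEta, hd, deltaEta, weightFactor, map_add, map_smul, map_smul, map_smul, h5,
    contractVec_theta, smul_zero, zero_add, smul_neg, smul_neg, smul_smul, smul_smul, ← neg_smul,
    ← sub_smul]
  have hpi : (Real.pi : ℂ) ≠ 0 := by exact_mod_cast Real.pi_ne_zero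
  have : -((coefB c j x : ℂ) * (Complex.I / (2 * Real.pi)) * eta x j) -
      (coefB c j x : ℂ) * (x.2 j - x.1 j) = 0 := by
    unfold eta
    field_simp
    ring_nf
    simp
  rw [this, zero_smul]

/-- The weight `∏ (χ(c²|w_j|²) + (i / 2π) c² χ'(c²|w_j|²) dw̄_j ∧ dw_j)`, a `∇_η`-closed form which
is `1` near the diagonal and is supported near the diagonal. -/
def weight {n : ℕ} (c : ℝ) (x : Pt n) : Forms n :=
  (List.ofFn fun j : Fin n => weightFactor c j x).prod

/-- A product of even `∇_η`-closed smooth forms is again even, `∇_η`-closed and smooth. -/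
theorem listProd_closed {n : ℕ} (l : List (Pt n → Forms n))
    (h : ∀ F ∈ l, ContDiff ℝ ∞ F ∧ ∀ x, signHom n (F x) = F x ∧ nablaEta F x = 0) :
    ContDiff ℝ ∞ (fun x => (l.map fun F => F x).prod) ∧
      ∀ x, signHom n (l.map fun F => F x).prod = (l.map fun F => F x).prod ∧
        nablaEta (fun x => (l.map fun F => F x).prod) x = 0 := by
  induction l with
  | nil => exact ⟨contDiff_const, fun x => ⟨map_one _, nablaEta_const_one x⟩⟩
  | cons F l ih =>
    obtain ⟨hF, hF'⟩ := h F (by simp)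
    obtain ⟨hl, hl'⟩ := ih fun G hG => h G (by simp [hG])
    simp only [List.map_cons, List.prod_cons]
    refine ⟨hF.form_mul hl, fun x => ⟨by rw [map_mul, (hF' x).1, (hl' x).1], ?_⟩⟩
    rw [nablaEta_mul (hF.differentiable (by simp) x) (hl.differentiable (by simp) x), (hF' x).2,
      (hl' x).2, zero_mul, mul_zero, add_zero]

theorem weight_eq_map {n : ℕ} (c : ℝ) (x : Pt n) :
    weight c x = ((List.ofFn fun j : Fin n => weightFactor c j).map fun F => F x).prod := by
  rw [List.map_ofFn]
  rfl

theorem weight_closed {n : ℕ} (c : ℝ) :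
    ContDiff ℝ ∞ (weight (n := n) c) ∧
      ∀ x : Pt n, signHom n (weight c x) = weight c x ∧ nablaEta (weight c) x = 0 := by
  have := listProd_closed (List.ofFn fun j : Fin n => weightFactor c j) (by
    intro F hF
    obtain ⟨j, rfl⟩ := (List.mem_ofFn' _ _).1 hF
    exact ⟨contDiff_weightFactor c j, fun x => ⟨signHom_weightFactor c j x,
      nablaEta_weightFactor c j x⟩⟩)
  simp only [← weight_eq_map] at this
  exact this

/-- The coefficient of `∏_{j ∈ J} (i / 2π) θ_j` in the weight. -/
def weightCoef {n : ℕ} (c : ℝ) (J : Finset (Fin n)) (x : Pt n) : ℝ :=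
  (∏ j ∈ J, coefB c j x) * ∏ j ∈ Finset.univ \ J, coefA c j x

/-- The expansion of the weight over the sets `J` of indices for which the `θ_j`-term is taken. -/
theorem weight_eq_sum {n : ℕ} (c : ℝ) (x : Pt n) :
    weight c x = ∑ J : Finset (Fin n),
      (weightCoef c J x : ℂ) • ((Complex.I / (2 * Real.pi)) ^ J.card • thetaProd J) := by
  have h : weight c x = thetaHom n (∏ j : Fin n,
      ((coefB c j x * (Complex.I / (2 * Real.pi)) : ℂ) • MvPolynomial.X j +
        (coefA c j x : ℂ) • 1)) := by
    rw [← List.prod_ofFn, map_list_prod, List.map_ofFn, weight]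
    congr 2
    funext j
    rw [Function.comp_apply, map_add, map_smul, map_smul, map_one, thetaHom_X, weightFactor,
      smul_smul, add_comm]
  rw [h, Finset.prod_add, map_sum, Finset.powerset_univ]
  refine Finset.sum_congr rfl fun J _ => ?_
  rw [Finset.prod_smul, Finset.prod_smul, Finset.prod_const_one, smul_mul_assoc, mul_smul_comm,
    mul_one, map_smul, map_smul, smul_smul, smul_smul, thetaProd, Finset.prod_mul_distrib,
    Finset.prod_const, weightCoef]
  congr 1
  push_cast
  ring

theorem weight_eq_one {n : ℕ} {c : ℝ} {x : Pt n} (h : ∀ j, c ^ 2 * sqW j x < 1) :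
    weight c x = 1 := by
  have : ∀ j : Fin n, weightFactor c j x = 1 := fun j => by
    simp [weightFactor, coefA, coefB, cutoff_of_le_one (h j).le, deriv_cutoff_of_lt_one (h j)]
  simp [weight, this]

/-! ### Integrability near the diagonal -/

theorem measurePreserving_shear (n : ℕ) :
    MeasurePreserving (fun x : Pt n => (x.1, x.2 - x.1)) volume volume :=
  measurePreserving_prod_sub volume volume

theorem volume_diagonal {n : ℕ} (hn : 0 < n) : volume (diagonal n) = 0 := by
  have : Nonempty (Fin n) := ⟨⟨0, hn⟩⟩
  have h : diagonal n = (fun x : Pt n => (x.1, x.2 - x.1)) ⁻¹' (Set.univ ×ˢ {0}) := by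
    ext x
    simp [diagonal, sub_eq_zero, eq_comm]
  rw [h, (measurePreserving_shear n).measure_preimage
    (MeasurableSet.univ.prod (measurableSet_singleton 0)).nullMeasurableSet]
  exact (Measure.prod_prod _ _).trans (by simp)

theorem integrableOn_norm_inv_pow {n m : ℕ} (hm : m + 1 ≤ 2 * n) (R : ℝ) :
    IntegrableOn (fun w : Fin n → ℂ => (‖w‖ ^ m)⁻¹) (Metric.ball 0 R) := by
  have : Nonempty (Fin n) := ⟨⟨0, by omega⟩⟩
  refine (integrableOn_fun_norm_addHaar volume (f := fun y => (y ^ m)⁻¹)).2 ?_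
  have hdim : Module.finrank ℝ (Fin n → ℂ) = 2 * n := by
    rw [Module.finrank_pi_fintype]
    simp [mul_comm]
  rw [hdim]
  have h : IntegrableOn (fun y : ℝ => y ^ (2 * n - 1 - m)) (Set.Ioo 0 R) :=
    ((continuous_pow _).integrableOn_Icc (a := 0) (b := R)).mono_set Set.Ioo_subset_Icc_self
  refine h.congr_fun (fun y hy => ?_) measurableSet_Ioo
  have hy0 : y ≠ 0 := hy.1.ne'
  simp only [smul_eq_mul]
  rw [← div_eq_mul_inv, eq_div_iff (pow_ne_zero m hy0), ← pow_add]
  congr 1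
  omega

/-- The powers `|w|^{-m}` are integrable near the diagonal for `m < 2n`, the real codimension. -/
theorem integrableOn_norm_sub_inv_pow {n m : ℕ} (hm : m + 1 ≤ 2 * n) {K : Set (Pt n)}
    (hK : IsCompact K) : IntegrableOn (fun x : Pt n => (‖x.2 - x.1‖ ^ m)⁻¹) K := by
  obtain ⟨R, hR⟩ := hK.isBounded.subset_ball 0
  have hprod : IntegrableOn (fun x : Pt n => (‖x.2‖ ^ m)⁻¹)
      (Metric.ball 0 R ×ˢ Metric.ball 0 (R + R)) := by
    have h1 : IntegrableOn (fun _ : Fin n → ℂ => (1 : ℝ)) (Metric.ball 0 R) :=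
      integrableOn_const (by exact measure_ball_lt_top.ne)
    have h2 := Integrable.mul_prod h1 (integrableOn_norm_inv_pow hm (R + R))
    rw [Measure.prod_restrict] at h2
    simp only [one_mul] at h2
    exact h2
  have := (measurePreserving_shear n).restrict_preimage
    (s := Metric.ball 0 R ×ˢ Metric.ball 0 (R + R))
    (measurableSet_ball.prod measurableSet_ball)
  have h3 : IntegrableOn (fun x : Pt n => (‖x.2 - x.1‖ ^ m)⁻¹) _ :=
    (this.integrable_comp hprod.aestronglyMeasurable).2 hprod
  refine h3.mono_set fun x hx => ?_
  have hx' := hR hx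
  rw [mem_ball_zero_iff, Prod.norm_def, max_lt_iff] at hx'
  refine ⟨by simpa using hx'.1, ?_⟩
  rw [mem_ball_zero_iff]
  exact (norm_sub_le _ _).trans_lt (by linarith [hx'.1, hx'.2])

theorem sqW_eq {n : ℕ} (j : Fin n) (x : Pt n) : sqW j x = ‖(x.2 - x.1) j‖ ^ 2 := by
  rw [sqW, Complex.normSq_eq_norm_sq, Pi.sub_apply]

/-- The coefficients of the weight vanish unless `c² |w_j|² ≤ 2` for every `j`. -/
theorem weightCoef_eq_zero {n : ℕ} {c : ℝ} {J : Finset (Fin n)} {x : Pt n} {j : Fin n}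
    (h : 2 < c ^ 2 * sqW j x) : weightCoef c J x = 0 := by
  by_cases hj : j ∈ J
  · rw [weightCoef, Finset.prod_eq_zero hj, zero_mul]
    rw [coefB, deriv_cutoff_of_two_lt h, mul_zero]
  · rw [weightCoef, Finset.prod_eq_zero (s := Finset.univ \ J) (i := j) (by simpa using hj),
      mul_zero]
    exact cutoff_of_two_le h.le

theorem exists_deriv_cutoff_le : ∃ D : ℝ, 0 ≤ D ∧ ∀ s, |deriv cutoff s| ≤ D := by
  obtain ⟨D, hD⟩ := (isCompact_Icc (a := (0 : ℝ)) (b := 3)).exists_bound_of_continuousOn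
    contDiff_deriv_cutoff.continuous.continuousOn
  refine ⟨D, (abs_nonneg _).trans (hD 0 (by simp)), fun s => ?_⟩
  by_cases h : s ∈ Set.Icc (0 : ℝ) 3
  · exact hD s h
  · have : deriv cutoff s = 0 := by
      rw [Set.mem_Icc, not_and_or, not_le, not_le] at h
      rcases h with h | h
      · exact deriv_cutoff_of_lt_one (by linarith)
      · exact deriv_cutoff_of_two_lt (by linarith)
    rw [this, abs_zero]
    exact (abs_nonneg _).trans (hD 0 (by simp))

/-- The coefficient of `θ_J` is `O(|w|^{-2|J|})` uniformly in `c`: it is of size `c^{2|J|}` on a set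
where `c |w|` is bounded. -/
theorem exists_weightCoef_le {n : ℕ} (J : Finset (Fin n)) :
    ∃ D : ℝ, 0 ≤ D ∧ ∀ (c : ℝ) (x : Pt n), x ∉ diagonal n →
      |weightCoef c J x| ≤ D * (‖x.2 - x.1‖ ^ (2 * J.card))⁻¹ := by
  obtain ⟨D, hD0, hD⟩ := exists_deriv_cutoff_le
  refine ⟨(2 * D) ^ J.card, by positivity, fun c x hx => ?_⟩
  have hw : 0 < ‖x.2 - x.1‖ := norm_pos_iff.2 fun h => hx (sub_eq_zero.1 h).symm
  by_cases h : ∃ j, 2 < c ^ 2 * sqW j x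
  · obtain ⟨j, hj⟩ := h
    rw [weightCoef_eq_zero hj, abs_zero]
    positivity
  push Not at h
  -- the bounds on all the `|w_j|` together bound `c |w|`
  have hc : c ^ 2 * ‖x.2 - x.1‖ ^ 2 ≤ 2 := by
    have : ‖|c| • (x.2 - x.1)‖ ≤ √2 := by
      rw [pi_norm_le_iff_of_nonneg (by positivity)]
      intro j
      refine Real.le_sqrt_of_sq_le ?_
      have := h j
      rw [sqW_eq] at this
      simpa [norm_smul, mul_pow] using this
    rw [norm_smul, norm_abs_eq_norm, Real.norm_eq_abs] at this
    have h2 := pow_le_pow_left₀ (by positivity) this 2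
    rwa [mul_pow, sq_abs, Real.sq_sqrt (by norm_num)] at h2
  have hA : |∏ j ∈ Finset.univ \ J, coefA c j x| ≤ 1 := by
    rw [Finset.abs_prod]
    refine Finset.prod_le_one (fun _ _ => abs_nonneg _) fun j _ => ?_
    rw [coefA, cutoff, abs_of_nonneg (Real.smoothTransition.nonneg _)]
    exact Real.smoothTransition.le_one _
  have hB : |∏ j ∈ J, coefB c j x| ≤ (2 * D * (‖x.2 - x.1‖ ^ 2)⁻¹) ^ J.card := by
    rw [Finset.abs_prod, ← Finset.prod_const]
    refine Finset.prod_le_prod (fun _ _ => abs_nonneg _) fun j _ => ?_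
    rw [coefB, abs_mul, abs_of_nonneg (sq_nonneg c)]
    calc c ^ 2 * |deriv cutoff (c ^ 2 * sqW j x)| ≤ (2 * (‖x.2 - x.1‖ ^ 2)⁻¹) * D := by
          refine mul_le_mul ?_ (hD _) (abs_nonneg _) (by positivity)
          rwa [← div_eq_mul_inv, le_div_iff₀ (by positivity)]
      _ = _ := by ring
  rw [weightCoef, abs_mul]
  calc _ ≤ (2 * D * (‖x.2 - x.1‖ ^ 2)⁻¹) ^ J.card * 1 :=
        mul_le_mul hB hA (abs_nonneg _) (by positivity)
    _ = _ := by rw [mul_one, mul_pow, inv_pow, ← pow_mul]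

theorem continuous_weightCoef {n : ℕ} (c : ℝ) (J : Finset (Fin n)) : Continuous (weightCoef c J) :=
  (continuous_finsetProd _ fun j _ => (contDiff_coefB c j).continuous).mul
    (continuous_finsetProd _ fun j _ => (contDiff_coefA c j).continuous)

/-- The terms of the weight which are less singular than the codimension of the diagonal
disappear in the limit, by dominated convergence. -/
theorem tendsto_integral_weightCoef_mul {n m : ℕ} {J : Finset (Fin n)}
    (hm : m + 2 * J.card + 1 ≤ 2 * n) {h : Pt n → ℂ} (hmeas : AEStronglyMeasurable h)
    {K : Set (Pt n)} (hK : IsCompact K) (hzero : ∀ x ∉ K, h x = 0) {C : ℝ}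
    (hC : ∀ x ∉ diagonal n, ‖h x‖ ≤ C * (‖x.2 - x.1‖ ^ m)⁻¹) :
    (∀ c : ℝ, Integrable fun x => (weightCoef c J x : ℂ) * h x) ∧
      Filter.Tendsto (fun c : ℝ => ∫ x, (weightCoef c J x : ℂ) * h x) Filter.atTop (nhds 0) := by
  obtain ⟨D, hD0, hD⟩ := exists_weightCoef_le J
  have hae : ∀ᵐ x : Pt n, x ∉ diagonal n := measure_eq_zero_iff_ae_notMem.1
    (volume_diagonal (by omega))
  set b : Pt n → ℝ := K.indicator fun x => D * C * (‖x.2 - x.1‖ ^ (m + 2 * J.card))⁻¹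
  have hb : Integrable b := (integrable_indicator_iff hK.measurableSet).2
    ((integrableOn_norm_sub_inv_pow hm hK).const_mul _)
  have hF (c : ℝ) : AEStronglyMeasurable fun x => (weightCoef c J x : ℂ) * h x :=
    (Complex.continuous_ofReal.comp (continuous_weightCoef c J)).aestronglyMeasurable.mul hmeas
  have hbound (c : ℝ) : ∀ᵐ x : Pt n, ‖(weightCoef c J x : ℂ) * h x‖ ≤ b x := by
    filter_upwards [hae] with x hx
    by_cases hxK : x ∈ K
    · rw [norm_mul, Complex.norm_real, Real.norm_eq_abs]
      refine (mul_le_mul (hD c x hx) (hC x hx) (norm_nonneg _) (by positivity)).trans ?_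
      simp only [b, Set.indicator_of_mem hxK]
      rw [pow_add, mul_inv]
      exact le_of_eq (by ring)
    · simp [b, hzero x hxK, hxK]
  refine ⟨fun c => hb.mono' (hF c) (hbound c), ?_⟩
  have := tendsto_integral_filter_of_dominated_convergence (l := Filter.atTop)
    (F := fun (c : ℝ) x => (weightCoef c J x : ℂ) * h x) (f := fun _ => 0) b
    (Filter.Eventually.of_forall hF) (Filter.Eventually.of_forall hbound) hb ?_
  · simpa using this
  filter_upwards [hae] with x hx
  obtain ⟨j, hj⟩ : ∃ j, (x.2 - x.1) j ≠ 0 := by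
    by_contra! hcon
    exact hx (sub_eq_zero.1 (funext hcon)).symm
  -- off the diagonal the coefficient is eventually zero
  refine tendsto_const_nhds.congr' ?_
  have hpos : 0 < sqW j x := by
    rw [sqW_eq]
    have := norm_pos_iff.2 hj
    positivity
  have hlim : Filter.Tendsto (fun c : ℝ => c ^ 2 * sqW j x) Filter.atTop Filter.atTop :=
    (Filter.tendsto_pow_atTop two_ne_zero).atTop_mul_const hpos
  filter_upwards [hlim.eventually_gt_atTop 2] with c hc
  rw [weightCoef_eq_zero hc, Complex.ofReal_zero, zero_mul]

/-! ### The top term of the weight is an approximate identity -/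

theorem integral_deriv_cutoff_normSq : ∫ w : ℂ, deriv cutoff (‖w‖ ^ 2) = -Real.pi := by
  have hcont : Continuous fun y : ℝ => y ^ (2 - 1) • deriv cutoff (y ^ 2) :=
    (continuous_pow _).smul (contDiff_deriv_cutoff.continuous.comp (continuous_pow 2))
  have hint : IntegrableOn (fun y : ℝ => y ^ (2 - 1) • deriv cutoff (y ^ 2)) (Set.Ioi 0) := by
    refine (hcont.integrable_of_hasCompactSupport
      (HasCompactSupport.intro (isCompact_Icc (a := -2) (b := 2)) fun y hy => ?_)).integrableOn
    rw [deriv_cutoff_of_two_lt, smul_zero]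
    rw [Set.mem_Icc, not_and_or, not_le, not_le] at hy
    rcases hy with hy | hy <;> nlinarith
  have hder (y : ℝ) : HasDerivAt (fun y : ℝ => cutoff (y ^ 2) / 2)
      (y ^ (2 - 1) • deriv cutoff (y ^ 2)) y := by
    have h1 := ((contDiff_cutoff.differentiable (by simp)) (y ^ 2)).hasDerivAt.comp y
      (hasDerivAt_pow 2 y)
    convert! h1.div_const 2 using 1
    simp
    ring
  have hlim : Filter.Tendsto (fun y : ℝ => cutoff (y ^ 2) / 2) Filter.atTop (nhds 0) := by
    refine tendsto_const_nhds.congr' ?_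
    filter_upwards [Filter.eventually_gt_atTop 2] with y hy
    rw [cutoff_of_two_le (by nlinarith), zero_div]
  have := integral_Ioi_of_hasDerivAt_of_tendsto' (fun y _ => hder y) hint hlim
  rw [integral_fun_norm_addHaar volume (fun y => deriv cutoff (y ^ 2)),
    Complex.finrank_real_complex, this, cutoff_of_le_one (by norm_num), Measure.real,
    Complex.volume_ball]
  simp
  ring

/-- The function `∏_j (-χ'(|w_j|²) / π)` on `ℂⁿ`, of integral one. Up to a constant, its rescalings
are the coefficients of `θ_1 ⋯ θ_n` in the weights. -/
def bump {n : ℕ} (w : Fin n → ℂ) : ℝ := ∏ j, (-(Real.pi⁻¹ * deriv cutoff (‖w j‖ ^ 2)))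

theorem bump_nonneg {n : ℕ} (w : Fin n → ℂ) : 0 ≤ bump w :=
  Finset.prod_nonneg fun j _ => by
    have := antitone_cutoff.deriv_nonpos (x := ‖w j‖ ^ 2)
    have := Real.pi_pos
    rw [← mul_neg]
    exact mul_nonneg (by positivity) (by linarith)

theorem integral_bump (n : ℕ) : ∫ w : Fin n → ℂ, bump w = 1 := by
  unfold bump
  rw [integral_fintype_prod_volume_eq_prod
    (fun (_ : Fin n) (z : ℂ) => -(Real.pi⁻¹ * deriv cutoff (‖z‖ ^ 2)))]
  refine Finset.prod_eq_one fun j _ => ?_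
  rw [integral_neg, integral_const_mul, integral_deriv_cutoff_normSq]
  have := Real.pi_ne_zero
  field_simp

theorem bump_eq_zero {n : ℕ} {w : Fin n → ℂ} (h : 2 < ‖w‖) : bump w = 0 := by
  have : ∃ j, 2 < ‖w j‖ := by
    by_contra! hcon
    exact absurd ((pi_norm_le_iff_of_nonneg (by norm_num)).2 hcon) (not_le.2 h)
  obtain ⟨j, hj⟩ := this
  refine Finset.prod_eq_zero (Finset.mem_univ j) ?_
  rw [deriv_cutoff_of_two_lt (by nlinarith), mul_zero, neg_zero]

/-- The coefficient of `θ_1 ⋯ θ_n` in the coordinates `(ζ, w)`, with `z = ζ + w`. -/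
theorem weightCoef_univ {n : ℕ} (c : ℝ) (ζ w : Fin n → ℂ) :
    weightCoef c Finset.univ (ζ, ζ + w) = (-Real.pi) ^ n * (c ^ (2 * n) * bump (c • w)) := by
  have h (j : Fin n) : coefB c j (ζ, ζ + w) =
      (-Real.pi) * (c ^ 2 * (-(Real.pi⁻¹ * deriv cutoff (‖(c • w) j‖ ^ 2)))) := by
    have := Real.pi_ne_zero
    rw [coefB, sqW_eq, Pi.smul_apply, norm_smul, mul_pow, Real.norm_eq_abs, sq_abs]
    simp only [add_sub_cancel_left]
    field_simp
  simp only [weightCoef, h, bump, Finset.sdiff_self, Finset.prod_empty, mul_one,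
    Finset.prod_mul_distrib, Finset.prod_const, Finset.card_univ, Fintype.card_fin, ← pow_mul]

/-- The coefficient of `θ_1 ⋯ θ_n` in the weight converges to a multiple of integration over the
diagonal. -/
theorem tendsto_integral_weightCoef_univ {n : ℕ} {a : Pt n → ℂ} (ha : Continuous a)
    (hc : HasCompactSupport a) :
    Filter.Tendsto (fun c : ℝ => ∫ x, (weightCoef c Finset.univ x : ℂ) * a x) Filter.atTop
      (nhds ((-Real.pi : ℂ) ^ n * ∫ ζ : Fin n → ℂ, a (ζ, ζ))) := by
  have hdim : Module.finrank ℝ (Fin n → ℂ) = 2 * n := by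
    rw [Module.finrank_pi_fintype]
    simp [mul_comm]
  -- pass to the coordinates `(ζ, w)` and integrate over `ζ` first
  let T : Pt n ≃ₜ Pt n := Homeomorph.shearAddRight (Fin n → ℂ)
  have hT (x : Pt n) : T x = (x.1, x.1 + x.2) := rfl
  have hTm : MeasurePreserving T volume volume := measurePreserving_prod_add volume volume
  set A : Pt n → ℂ := fun x => a (x.1, x.1 + x.2) with hA
  have hAc : Continuous A := ha.comp T.continuous
  have hAs : HasCompactSupport A := hc.comp_homeomorph T
  have hAi : Integrable A := hAc.integrable_of_hasCompactSupport hAs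
  set g : (Fin n → ℂ) → ℂ := fun w => ∫ ζ, A (ζ, w) with hg
  have hgi : Integrable g := Integrable.integral_prod_right hAi
  have hgc : Continuous g := by
    have hs : IsCompact (Prod.fst '' tsupport A) := hAs.isCompact.image continuous_fst
    have h1 := continuous_parametric_integral_of_continuous (μ := (volume : Measure (Fin n → ℂ)))
      (f := fun w ζ => A (ζ, w)) (hAc.comp continuous_swap) hs
    convert! h1 using 1
    funext w
    refine (setIntegral_eq_integral_of_forall_compl_eq_zero fun ζ hζ => ?_).symm
    by_contra h
    exact hζ ⟨(ζ, w), subset_tsupport _ h, rfl⟩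
  have hpeak := tendsto_integral_comp_smul_smul_of_integrable (μ := (volume : Measure (Fin n → ℂ)))
    (φ := bump) bump_nonneg (integral_bump n) ?_ hgi hgc.continuousAt
  swap
  · refine tendsto_const_nhds.congr' ?_
    filter_upwards [(tendsto_norm_cobounded_atTop (E := Fin n → ℂ)).eventually_gt_atTop 2] with w hw
    rw [bump_eq_zero hw, mul_zero]
  have hg0 : g 0 = ∫ ζ : Fin n → ℂ, a (ζ, ζ) := by simp [hg, hA]
  rw [hg0, hdim] at hpeak
  refine (hpeak.const_mul ((-Real.pi : ℂ) ^ n)).congr fun c => ?_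
  have hint : Integrable fun x : Pt n => (weightCoef c Finset.univ (x.1, x.1 + x.2) : ℂ) * A x := by
    refine Continuous.integrable_of_hasCompactSupport ?_ hAs.mul_left
    exact (Complex.continuous_ofReal.comp
      ((continuous_weightCoef c _).comp T.continuous)).mul hAc
  rw [← hTm.integral_comp T.measurableEmbedding]
  simp only [hT]
  refine Eq.trans ?_ (integral_prod_symm _ hint).symm
  rw [← integral_const_mul]
  refine integral_congr_ae (Filter.Eventually.of_forall fun w => ?_)
  simp only [weightCoef_univ]
  rw [integral_const_mul, Complex.real_smul]
  push_cast
  ring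

/-! ### Forms with the growth of the Bochner-Martinelli kernel -/

variable {n : ℕ} {Ω : Opens (Fin n → ℂ)}

theorem isClosed_diagonal (n : ℕ) : IsClosed (diagonal n) :=
  isClosed_eq continuous_fst continuous_snd

theorem isOpen_offDiagonal (Ω : Opens (Fin n → ℂ)) :
    IsOpen ((square Ω : Set (Pt n)) \ diagonal n) :=
  (square Ω).isOpen.sdiff (isClosed_diagonal n)

theorem norm_sub_le_absEta (x : Pt n) : ‖x.2 - x.1‖ ≤ absEta x := by
  refine (pi_norm_le_iff_of_nonneg (Real.sqrt_nonneg _)).2 fun j => ?_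
  refine Real.le_sqrt_of_sq_le ?_
  have h1 : ‖(x.2 - x.1) j‖ ≤ ‖eta x j‖ := by
    have : (1 : ℝ) ≤ 2 * Real.pi := by linarith [Real.pi_gt_three]
    simp only [eta, norm_mul, Complex.norm_I, mul_one, Complex.norm_real, Complex.norm_ofNat,
      Real.norm_eq_abs, abs_of_pos Real.pi_pos, Pi.sub_apply]
    exact le_mul_of_one_le_left (norm_nonneg _) this
  exact (pow_le_pow_left₀ (norm_nonneg _) h1 2).trans
    (Finset.single_le_sum (f := fun i => ‖eta x i‖ ^ 2) (fun _ _ => by positivity)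
      (Finset.mem_univ j))

theorem comp_zero_eq_zero (u : LSection n (-1) ((square Ω : Set (Pt n)) \ diagonal n)) {x : Pt n}
    (hx : x ∈ (square Ω : Set (Pt n)) \ diagonal n) : u.comp 0 x = 0 := by
  have h := u.mem 0 x hx
  rw [bidegree, if_neg (by simp)] at h
  exact (Submodule.mem_bot (M := ExteriorAlgebra ℂ (Covec n)) ℂ).1 h

/-- The growth hypothesis on the components, in terms of `|w|`. For `p = 0` the truncated exponent
`2p - 1` is `0`; the component `u_0` vanishes anyway. -/
def GrowthBound (u : LSection n (-1) ((square Ω : Set (Pt n)) \ diagonal n)) : Prop :=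
  ∀ p ≤ n, ∀ K : Set (Pt n), IsCompact K → K ⊆ (square Ω : Set (Pt n)) →
    ∃ C : ℝ, 0 ≤ C ∧ ∀ x ∈ K \ diagonal n, ‖u.comp p x‖ ≤ C * (‖x.2 - x.1‖ ^ (2 * p - 1))⁻¹

theorem growthBound_of_absEta {u : LSection n (-1) ((square Ω : Set (Pt n)) \ diagonal n)}
    (hgrowth : ∀ k : ℕ, 1 ≤ k → k ≤ n →
      ∀ K : Set (Pt n), IsCompact K → K ⊆ (square Ω : Set (Pt n)) →
        ∃ C : ℝ, ∀ x ∈ K \ diagonal n,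
          ‖u.comp k x‖ ≤ C * absEta x ^ (-(2 * (k : ℤ) - 1))) : GrowthBound u := by
  intro p hp K hK hKs
  rcases Nat.eq_zero_or_pos p with rfl | hp0
  · exact ⟨0, le_rfl, fun x hx => by rw [comp_zero_eq_zero u ⟨hKs hx.1, hx.2⟩]; simp⟩
  obtain ⟨C, hC⟩ := hgrowth p hp0 hp K hK hKs
  refine ⟨|C|, abs_nonneg C, fun x hx => ?_⟩
  have hw : 0 < ‖x.2 - x.1‖ := norm_pos_iff.2 fun h => hx.2 (sub_eq_zero.1 h).symm
  have hz : (2 * (p : ℤ) - 1) = ((2 * p - 1 : ℕ) : ℤ) := by omega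
  have h1 := hC x hx
  rw [hz, zpow_neg, zpow_natCast] at h1
  refine h1.trans (mul_le_mul (le_abs_self C) ?_ ?_ (abs_nonneg C))
  · exact inv_anti₀ (by positivity) (pow_le_pow_left₀ hw.le (norm_sub_le_absEta x) _)
  · exact inv_nonneg.2 (pow_nonneg (Real.sqrt_nonneg _) _)

/-- A function which is continuous off the diagonal and vanishes outside `Ω × Ω` is measurable. -/
theorem aestronglyMeasurable_of_continuousOn {E : Type*} [NormedAddCommGroup E] (hn : 0 < n)
    {h : Pt n → E} (hcont : ContinuousOn h ((square Ω : Set (Pt n)) \ diagonal n))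
    (hzero : ∀ x ∉ (square Ω : Set (Pt n)), h x = 0) : AEStronglyMeasurable h := by
  have hm := (isOpen_offDiagonal Ω).measurableSet
  refine ((aestronglyMeasurable_indicator_iff hm).2 (hcont.aestronglyMeasurable hm)).congr ?_
  filter_upwards [measure_eq_zero_iff_ae_notMem.1 (volume_diagonal hn)] with x hx
  by_cases hs : x ∈ (square Ω : Set (Pt n))
  · rw [Set.indicator_of_mem (show x ∈ (square Ω : Set (Pt n)) \ diagonal n from ⟨hs, hx⟩)]
  · rw [Set.indicator_of_notMem fun h' => hs h'.1, hzero x hs]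

theorem integrableOn_comp (hn : 0 < n)
    {u : LSection n (-1) ((square Ω : Set (Pt n)) \ diagonal n)} (hu : GrowthBound u)
    {p : ℕ} (hp : p ≤ n) {K : Set (Pt n)} (hK : IsCompact K) (hKs : K ⊆ (square Ω : Set (Pt n))) :
    IntegrableOn (u.comp p) K := by
  obtain ⟨C, _, hC⟩ := hu p hp K hK hKs
  have hmeas : AEStronglyMeasurable (u.comp p) (volume.restrict K) := by
    have h1 : AEStronglyMeasurable ((square Ω : Set (Pt n)).indicator (u.comp p)) := by
      refine aestronglyMeasurable_of_continuousOn (Ω := Ω) hn ?_ fun x hx =>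
        Set.indicator_of_notMem hx _
      exact ((u.smooth p).continuousOn).congr fun x hx => Set.indicator_of_mem hx.1 _
    refine h1.restrict.congr ?_
    filter_upwards [ae_restrict_mem hK.measurableSet] with x hx
    exact Set.indicator_of_mem (hKs hx) _
  refine Integrable.mono' ((integrableOn_norm_sub_inv_pow (m := 2 * p - 1) (by omega) hK).const_mul C)
    hmeas ?_
  filter_upwards [ae_restrict_mem hK.measurableSet,
    ae_restrict_of_ae (measure_eq_zero_iff_ae_notMem.1 (volume_diagonal hn))] with x h1 h2
  exact hC x ⟨h1, h2⟩

theorem locallyIntegrableOn_toForm (hn : 0 < n)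
    {u : LSection n (-1) ((square Ω : Set (Pt n)) \ diagonal n)} (hu : GrowthBound u) :
    LocallyIntegrableOn u.toForm (square Ω : Set (Pt n)) := by
  rw [locallyIntegrableOn_iff (square Ω).isOpen.isLocallyClosed]
  intro K hKs hK
  exact integrable_finsetSum _ fun p hp =>
    integrableOn_comp hn hu (by simpa [Nat.lt_succ_iff] using hp) hK hKs

/-- The bilinear pairing `(a, y) ↦ topCoeff (a ∧ b ∧ y)`. -/
def topPairing (b : Forms n) : Forms n →L[ℂ] Forms n →L[ℂ] ℂ :=
  ((LinearMap.mul ℂ (Forms n) ∘ₗ LinearMap.mulRight ℂ b).compr₂ (topCoeff n)).toContinuousBilinearMap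

theorem topPairing_apply (a b y : Forms n) : topPairing b a y = topCoeff n (a * b * y) := rfl

theorem exists_norm_topCoeff_le (b : Forms n) (φ : 𝓓(square Ω, Forms n)) :
    ∃ C : ℝ, 0 ≤ C ∧ ∀ (a : Forms n) (x : Pt n), ‖topCoeff n (a * b * φ x)‖ ≤ C * ‖a‖ := by
  obtain ⟨M, hM⟩ := φ.hasCompactSupport.exists_bound_of_continuous φ.continuous
  have hM0 : 0 ≤ M := (norm_nonneg _).trans (hM 0)
  refine ⟨‖topPairing b‖ * M, by positivity, fun a x => ?_⟩
  rw [← topPairing_apply]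
  refine ((topPairing b).le_opNorm₂ a (φ x)).trans ?_
  calc _ ≤ ‖topPairing b‖ * ‖a‖ * M := by gcongr; exact hM x
    _ = _ := by ring

theorem test_eq_zero (φ : 𝓓(square Ω, Forms n)) {x : Pt n} (hx : x ∉ tsupport φ) : φ x = 0 :=
  image_eq_zero_of_notMem_tsupport hx

/-- The terms of `u ∧ g_c` (where `g_c` is the weight) do not contribute in the limit: either they
vanish because their degree in `E*` exceeds `n`, or they are integrable uniformly in `c`. -/
theorem tendsto_integral_comp_mul_thetaProd (hn : 0 < n)
    {u : LSection n (-1) ((square Ω : Set (Pt n)) \ diagonal n)} (hu : GrowthBound u)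
    {p : ℕ} (hp : p ≤ n) (J : Finset (Fin n)) (κ : ℂ) (φ : 𝓓(square Ω, Forms n)) :
    (∀ c : ℝ, Integrable fun x =>
      (weightCoef c J x : ℂ) * topCoeff n (u.comp p x * (κ • thetaProd J) * φ x)) ∧
    Filter.Tendsto (fun c : ℝ => ∫ x,
      (weightCoef c J x : ℂ) * topCoeff n (u.comp p x * (κ • thetaProd J) * φ x))
      Filter.atTop (nhds 0) := by
  by_cases hvan : p = 0 ∨ n < p + J.card
  · have h0 : ∀ᵐ x : Pt n, topCoeff n (u.comp p x * (κ • thetaProd J) * φ x) = 0 := by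
      filter_upwards [measure_eq_zero_iff_ae_notMem.1 (volume_diagonal hn)] with x hx
      by_cases hs : x ∈ tsupport φ
      · have hxU : x ∈ (square Ω : Set (Pt n)) \ diagonal n := ⟨φ.tsupport_subset hs, hx⟩
        rcases hvan with rfl | h
        · rw [comp_zero_eq_zero u hxU, zero_mul, zero_mul, map_zero]
        · rw [mul_smul_comm, mul_thetaProd_eq_zero h (u.mem p x hxU), smul_zero, zero_mul, map_zero]
      · rw [test_eq_zero φ hs, mul_zero, map_zero]
    have h1 (c : ℝ) : (fun x => (weightCoef c J x : ℂ) *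
        topCoeff n (u.comp p x * (κ • thetaProd J) * φ x)) =ᵐ[volume] fun _ => 0 := by
      filter_upwards [h0] with x hx
      rw [hx, mul_zero]
    refine ⟨fun c => (integrable_zero _ _ _).congr (h1 c).symm, ?_⟩
    refine tendsto_const_nhds.congr fun c => ?_
    rw [integral_congr_ae (h1 c), integral_zero]
  · push Not at hvan
    obtain ⟨C, hC0, hC⟩ := hu p hp (tsupport φ) φ.hasCompactSupport φ.tsupport_subset
    obtain ⟨D, hD0, hD⟩ := exists_norm_topCoeff_le (κ • thetaProd J) φ
    refine tendsto_integral_weightCoef_mul (m := 2 * p - 1) (C := D * C)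
      (h := fun x => topCoeff n (u.comp p x * (κ • thetaProd J) * φ x)) (by omega) ?_
      φ.hasCompactSupport (fun x hx => by rw [test_eq_zero φ hx, mul_zero, map_zero]) ?_
    · refine aestronglyMeasurable_of_continuousOn (Ω := Ω) hn ?_ fun x hx => by
        rw [test_eq_zero φ fun h => hx (φ.tsupport_subset h), mul_zero, map_zero]
      have h1 := (topPairing (κ • thetaProd J)).isBoundedBilinearMap.continuous.comp_continuousOn
        (((u.smooth p).continuousOn).prodMk φ.continuous.continuousOn)
      exact h1
    · intro x hx
      by_cases hs : x ∈ tsupport φ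
      · calc _ ≤ D * ‖u.comp p x‖ := hD _ x
          _ ≤ D * (C * (‖x.2 - x.1‖ ^ (2 * p - 1))⁻¹) := by gcongr; exact hC x ⟨hs, hx⟩
          _ = _ := by ring
      · rw [test_eq_zero φ hs, mul_zero, map_zero, norm_zero]
        positivity

theorem continuous_topCoeff_mul (b : Forms n) (φ : 𝓓(square Ω, Forms n)) :
    Continuous fun x => topCoeff n (b * φ x) := by
  have h := ((topPairing 1) b).continuous.comp φ.continuous
  simp only [Function.comp_def, topPairing_apply, mul_one] at h
  exact h

theorem hasCompactSupport_topCoeff_mul (b : Forms n) (φ : 𝓓(square Ω, Forms n)) :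
    HasCompactSupport fun x => topCoeff n (b * φ x) :=
  φ.hasCompactSupport.mono' fun x hx => by
    by_contra h
    exact hx (by simp [test_eq_zero φ h])

/-- As `c → ∞`, the weight converges to the current of integration over the diagonal. -/
theorem tendsto_integral_weight (φ : 𝓓(square Ω, Forms n)) :
    (∀ c : ℝ, Integrable fun x => topCoeff n (weight c x * φ x)) ∧
    Filter.Tendsto (fun c : ℝ => ∫ x, topCoeff n (weight c x * φ x)) Filter.atTop
      (nhds (∫ w : Fin n → ℂ, diagCoeff n (φ (w, w)))) := by
  set b : Finset (Fin n) → Forms n := fun J => (Complex.I / (2 * Real.pi)) ^ J.card • thetaProd J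
  have hexp (c : ℝ) (x : Pt n) : topCoeff n (weight c x * φ x) =
      ∑ J : Finset (Fin n), (weightCoef c J x : ℂ) * topCoeff n (b J * φ x) := by
    rw [weight_eq_sum, Finset.sum_mul, map_sum]
    refine Finset.sum_congr rfl fun J _ => ?_
    rw [smul_mul_assoc, map_smul, smul_eq_mul]
  have hint (J : Finset (Fin n)) (c : ℝ) :
      Integrable fun x => (weightCoef c J x : ℂ) * topCoeff n (b J * φ x) :=
    ((Complex.continuous_ofReal.comp (continuous_weightCoef c J)).mul
      (continuous_topCoeff_mul (b J) φ)).integrable_of_hasCompactSupport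
      (hasCompactSupport_topCoeff_mul (b J) φ).mul_left
  have hlim (J : Finset (Fin n)) : Filter.Tendsto
      (fun c : ℝ => ∫ x, (weightCoef c J x : ℂ) * topCoeff n (b J * φ x)) Filter.atTop
      (nhds (if J = Finset.univ then ∫ w : Fin n → ℂ, diagCoeff n (φ (w, w)) else 0)) := by
    split_ifs with hJ
    · subst hJ
      have h := tendsto_integral_weightCoef_univ (continuous_topCoeff_mul (b Finset.univ) φ)
        (hasCompactSupport_topCoeff_mul (b Finset.univ) φ)
      convert! h using 2
      rw [← integral_const_mul]
      congr 1
      funext w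
      simp only [b]
      rw [smul_mul_assoc, map_smul, smul_eq_mul, thetaProd_univ, topCoeff_prod_theta_mul,
        Finset.card_univ, Fintype.card_fin, ← mul_assoc, ← mul_assoc, ← mul_pow, ← mul_pow]
      have hpi : (Real.pi : ℂ) ≠ 0 := by exact_mod_cast Real.pi_ne_zero
      -- the factors come from the integral of the bump, the weight, and the frame on the diagonal
      have : (-Real.pi : ℂ) * (Complex.I / (2 * Real.pi)) * (2 * Complex.I) = 1 := by
        field_simp
        simp
      rw [this, one_pow, one_mul]
    · have hcard : J.card < n := by
        have := Finset.card_lt_univ_of_notMem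
          (not_forall.1 fun h => hJ (Finset.eq_univ_iff_forall.2 h)).choose_spec
        simpa using this
      obtain ⟨D, hD0, hD⟩ := exists_norm_topCoeff_le 1 φ
      refine (tendsto_integral_weightCoef_mul (m := 0) (C := D * ‖b J‖) (by omega)
        (continuous_topCoeff_mul (b J) φ).aestronglyMeasurable φ.hasCompactSupport
        (fun x hx => by rw [test_eq_zero φ hx, mul_zero, map_zero]) fun x _ => ?_).2
      have := hD (b J) x
      rw [mul_one] at this
      simpa using this
  simp only [hexp]
  refine ⟨fun c => integrable_finsetSum _ fun J _ => hint J c, ?_⟩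
  have := tendsto_finsetSum (Finset.univ : Finset (Finset (Fin n))) fun J _ => hlim J
  rw [Finset.sum_ite_eq' Finset.univ Finset.univ, if_pos (Finset.mem_univ _)] at this
  refine this.congr fun c => ?_
  rw [integral_finsetSum _ fun J _ => hint J c]

/-- The integrals `∫ u ∧ g_c ∧ φ` tend to zero as `c → ∞`. -/
theorem tendsto_integral_toForm_mul_weight (hn : 0 < n)
    {u : LSection n (-1) ((square Ω : Set (Pt n)) \ diagonal n)} (hu : GrowthBound u)
    (φ : 𝓓(square Ω, Forms n)) :
    (∀ c : ℝ, Integrable fun x => topCoeff n (u.toForm x * weight c x * φ x)) ∧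
    Filter.Tendsto (fun c : ℝ => ∫ x, topCoeff n (u.toForm x * weight c x * φ x)) Filter.atTop
      (nhds 0) := by
  set κ : Finset (Fin n) → ℂ := fun J => (Complex.I / (2 * Real.pi)) ^ J.card
  have hexp (c : ℝ) (x : Pt n) : topCoeff n (u.toForm x * weight c x * φ x) =
      ∑ p ∈ Finset.range (n + 1), ∑ J : Finset (Fin n),
        (weightCoef c J x : ℂ) * topCoeff n (u.comp p x * (κ J • thetaProd J) * φ x) := by
    rw [weight_eq_sum, LSection.toForm, Finset.sum_mul, Finset.sum_mul, map_sum]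
    refine Finset.sum_congr rfl fun p _ => ?_
    rw [Finset.mul_sum, Finset.sum_mul, map_sum]
    refine Finset.sum_congr rfl fun J _ => ?_
    rw [mul_smul_comm, smul_mul_assoc, map_smul, smul_eq_mul]
  have hterm (p : ℕ) (hp : p ∈ Finset.range (n + 1)) (J : Finset (Fin n)) :=
    tendsto_integral_comp_mul_thetaProd hn hu (p := p) (by simpa [Nat.lt_succ_iff] using hp) J (κ J) φ
  simp only [hexp]
  refine ⟨fun c => integrable_finsetSum _ fun p hp => integrable_finsetSum _ fun J _ =>
    (hterm p hp J).1 c, ?_⟩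
  have := tendsto_finsetSum (Finset.range (n + 1)) fun p hp =>
    tendsto_finsetSum (Finset.univ : Finset (Finset (Fin n))) fun J _ => (hterm p hp J).2
  simp only [Finset.sum_const_zero] at this
  refine this.congr fun c => ?_
  rw [integral_finsetSum _ fun p hp => integrable_finsetSum _ fun J _ => (hterm p hp J).1 c]
  refine Finset.sum_congr rfl fun p hp => ?_
  rw [integral_finsetSum _ fun J _ => (hterm p hp J).1 c]

/-! ### Stokes' theorem and the passage to the limit -/

theorem eventually_weight_eq_one (c : ℝ) {x : Pt n} (hx : x ∈ diagonal n) :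
    ∀ᶠ y in nhds x, weight c y = 1 := by
  have h : ∀ᶠ y in nhds x, ∀ j : Fin n, c ^ 2 * sqW j y < 1 := by
    refine Filter.eventually_all.2 fun j => ?_
    have hc : Continuous fun y : Pt n => c ^ 2 * sqW j y :=
      continuous_const.mul (contDiff_sqW j).continuous
    refine hc.continuousAt.eventually_lt_const ?_
    have hx' : x.1 = x.2 := hx
    simp [sqW, hx']
  exact h.mono fun y hy => weight_eq_one hy

theorem contDiffOn_toForm {U : Set (Pt n)} {m : ℤ} (u : LSection n m U) :
    ContDiffOn ℝ ∞ u.toForm U :=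
  ContDiffOn.sum fun p _ => u.smooth p

theorem signHom_toForm {U : Set (Pt n)} (u : LSection n (-1) U) {x : Pt n} (hx : x ∈ U) :
    signHom n (u.toForm x) = -u.toForm x := by
  rw [LSection.toForm, map_sum, ← Finset.sum_neg_distrib]
  exact Finset.sum_congr rfl fun p _ => signHom_of_mem_bidegree (u.mem p x hx)

/-- The operator `∇_η` on test forms. -/
def nablaTest (φ : 𝓓(square Ω, Forms n)) : 𝓓(square Ω, Forms n) :=
  deltaTest (square Ω) φ - dbarTest (square Ω) φ

theorem nablaTest_apply (φ : 𝓓(square Ω, Forms n)) (x : Pt n) :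
    nablaTest φ x = nablaEta φ x := by
  rw [nablaEta, ← dbarTest_apply, ← deltaTest_apply (square Ω)]
  rfl

/-- Stokes' theorem for the form `u ∧ (1 - g_c) ∧ φ`, which is smooth because `1 - g_c` vanishes near
the diagonal. -/
theorem integral_toForm_mul_one_sub_weight (hn : 0 < n)
    {u : LSection n (-1) ((square Ω : Set (Pt n)) \ diagonal n)}
    (hu : ∀ x ∈ (square Ω : Set (Pt n)) \ diagonal n, nablaEta u.toForm x = 1)
    (c : ℝ) (φ : 𝓓(square Ω, Forms n))
    (h1 : Integrable fun x => topCoeff n (u.toForm x * (1 - weight c x) * nablaTest φ x))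
    (h2 : Integrable fun x => topCoeff n ((1 - weight c x) * φ x)) :
    ∫ x, topCoeff n (u.toForm x * (1 - weight c x) * nablaTest φ x) =
      ∫ x, topCoeff n ((1 - weight c x) * φ x) := by
  obtain ⟨hg, hg'⟩ := weight_closed (n := n) c
  have hd : ContDiff ℝ ∞ fun x : Pt n => 1 - weight c x := contDiff_const.sub hg
  set v : Pt n → Forms n := fun x => (1 - weight c x) * φ x with hv
  have hvs : ContDiff ℝ ∞ v := hd.form_mul φ.contDiff
  have hfar {x : Pt n} (hx : x ∉ tsupport φ) : (fun y => u.toForm y * v y) =ᶠ[nhds x] fun _ => 0 := by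
    filter_upwards [(isClosed_tsupport φ).isOpen_compl.mem_nhds hx] with y hy
    rw [hv]
    simp only
    rw [test_eq_zero φ hy, mul_zero, mul_zero]
  have hF : ContDiff ℝ ∞ fun x => u.toForm x * v x := by
    refine contDiff_iff_contDiffAt.2 fun x => ?_
    by_cases hx : x ∈ tsupport φ
    · by_cases hxd : x ∈ diagonal n
      · refine (contDiffAt_const (c := (0 : Forms n))).congr_of_eventuallyEq ?_
        filter_upwards [eventually_weight_eq_one c hxd] with y hy
        simp [hv, hy]
      · exact ((contDiffOn_toForm u).contDiffAt ((isOpen_offDiagonal Ω).mem_nhds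
          ⟨φ.tsupport_subset hx, hxd⟩)).form_mul hvs.contDiffAt
    · exact contDiffAt_const.congr_of_eventuallyEq (hfar hx)
  have hFc : HasCompactSupport fun x => u.toForm x * v x :=
    φ.hasCompactSupport.mono' fun x hx => by
      by_contra h
      exact hx (hfar h).eq_of_nhds
  have hvn (x : Pt n) : nablaEta v x = (1 - weight c x) * nablaTest φ x := by
    rw [hv, nablaEta_mul (hd.differentiable (by simp) x) (φ.contDiff.differentiable (by simp) x),
      nablaEta_sub (by fun_prop) (hg.differentiable (by simp) x), nablaEta_const_one, (hg' x).2,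
      map_sub, map_one, (hg' x).1, nablaTest_apply]
    simp
  have hst := integral_topCoeff_nablaEta hF hFc
  have hae : ∀ᵐ x : Pt n, topCoeff n (nablaEta (fun x => u.toForm x * v x) x) =
      topCoeff n ((1 - weight c x) * φ x) -
        topCoeff n (u.toForm x * (1 - weight c x) * nablaTest φ x) := by
    filter_upwards [measure_eq_zero_iff_ae_notMem.1 (volume_diagonal hn)] with x hxd
    by_cases hx : x ∈ tsupport φ
    · have hxU : x ∈ (square Ω : Set (Pt n)) \ diagonal n := ⟨φ.tsupport_subset hx, hxd⟩
      rw [nablaEta_mul (((contDiffOn_toForm u).contDiffAt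
        ((isOpen_offDiagonal Ω).mem_nhds hxU)).differentiableAt (by simp))
        (hvs.differentiable (by simp) x), hu x hxU, signHom_toForm u hxU, hvn, one_mul, neg_mul,
        ← mul_assoc, ← sub_eq_add_neg, map_sub]
    · have h0 : nablaEta (fun _ : Pt n => (0 : Forms n)) x = 0 := by
        simp [nablaEta, deltaEta, dbar, wirtingerBar]
      have h3 : nablaEta φ x = 0 := by
        rw [← h0]
        refine nablaEta_congr ?_
        filter_upwards [(isClosed_tsupport φ).isOpen_compl.mem_nhds hx] with y hy
          using test_eq_zero φ hy
      rw [nablaEta_congr (hfar hx), h0, test_eq_zero φ hx, nablaTest_apply, h3]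
      simp
  rw [integral_congr_ae hae, integral_sub h2 h1, sub_eq_zero] at hst
  exact hst.symm

theorem integrable_toForm_mul (hn : 0 < n)
    {u : LSection n (-1) ((square Ω : Set (Pt n)) \ diagonal n)} (hu : GrowthBound u)
    (φ : 𝓓(square Ω, Forms n)) : Integrable fun x => topCoeff n (u.toForm x * φ x) := by
  exact φ.integrable_bilin (wedgePairing n) (μ := volume) (locallyIntegrableOn_toForm hn hu)

/-- The current equation, tested on a form `φ` and written with `∇_η φ`. -/
theorem integral_toForm_mul_nablaTest (hn : 0 < n)
    {u : LSection n (-1) ((square Ω : Set (Pt n)) \ diagonal n)}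
    (hu : ∀ x ∈ (square Ω : Set (Pt n)) \ diagonal n, nablaEta u.toForm x = 1)
    (hg : GrowthBound u) (φ : 𝓓(square Ω, Forms n)) :
    ∫ x, topCoeff n (u.toForm x * nablaTest φ x) =
      (∫ x, topCoeff n (φ x)) - ∫ w : Fin n → ℂ, diagCoeff n (φ (w, w)) := by
  obtain ⟨hi1, hl1⟩ := tendsto_integral_toForm_mul_weight hn hg (nablaTest φ)
  obtain ⟨hi2, hl2⟩ := tendsto_integral_weight φ
  have hiu := integrable_toForm_mul hn hg (nablaTest φ)
  have hiφ : Integrable fun x => topCoeff n (φ x) := by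
    have := (continuous_topCoeff_mul 1 φ).integrable_of_hasCompactSupport
      (hasCompactSupport_topCoeff_mul 1 φ) (μ := volume)
    simpa using this
  have e1 (c : ℝ) (x : Pt n) : topCoeff n (u.toForm x * (1 - weight c x) * nablaTest φ x) =
      topCoeff n (u.toForm x * nablaTest φ x) -
        topCoeff n (u.toForm x * weight c x * nablaTest φ x) := by
    rw [mul_sub, mul_one, sub_mul, map_sub]
  have e2 (c : ℝ) (x : Pt n) : topCoeff n ((1 - weight c x) * φ x) =
      topCoeff n (φ x) - topCoeff n (weight c x * φ x) := by
    rw [sub_mul, one_mul, map_sub]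
  have key (c : ℝ) := integral_toForm_mul_one_sub_weight hn hu c φ
    (by simp only [e1]; exact hiu.sub (hi1 c)) (by simp only [e2]; exact hiφ.sub (hi2 c))
  simp only [e1, e2] at key
  have key' (c : ℝ) := (integral_sub hiu (hi1 c)).symm.trans
    ((key c).trans (integral_sub hiφ (hi2 c)))
  have hL := hl1.const_sub (∫ x, topCoeff n (u.toForm x * nablaTest φ x))
  rw [sub_zero] at hL
  exact tendsto_nhds_unique hL ((hl2.const_sub _).congr fun c => (key' c).symm)

/-- The current equation `∇_η u = 1 - [Δ]`. -/
theorem nablaEta_ofForm_toForm (hn : 0 < n)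
    {u : LSection n (-1) ((square Ω : Set (Pt n)) \ diagonal n)}
    (hu : ∀ x ∈ (square Ω : Set (Pt n)) \ diagonal n, nablaEta u.toForm x = 1)
    (hg : GrowthBound u) :
    (Current.ofForm (square Ω) u.toForm).nablaEta =
      Current.ofForm (square Ω) (fun _ => 1) - Current.diagonal Ω := by
  have hloc := locallyIntegrableOn_toForm hn hg
  ext φ
  set ψ := signTest (square Ω) φ with hψ
  have hψx (x : Pt n) : ψ x = signHom n (φ x) := rfl
  have hL : (Current.ofForm (square Ω) u.toForm).nablaEta φ =
      Current.ofForm (square Ω) u.toForm (nablaTest ψ) := by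
    rw [nablaTest, map_sub]
    rfl
  have hR : (Current.ofForm (square Ω) (fun _ => 1) - Current.diagonal Ω) φ =
      Current.ofForm (square Ω) (fun _ => 1) φ - Current.diagonal Ω φ := rfl
  rw [hL, hR, Current.ofForm_apply hloc,
    Current.ofForm_apply ((locallyIntegrable_const 1).locallyIntegrableOn _),
    Current.diagonal_apply, integral_toForm_mul_nablaTest hn hu hg,
    setIntegral_eq_integral_of_forall_compl_eq_zero]
  · simp only [hψx, topCoeff_signHom, diagCoeff_signHom, one_mul]
  · intro w hw
    rw [test_eq_zero φ fun h => hw (φ.tsupport_subset h).1, map_zero]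

end

end Koppelman

theorem mainTheorem7 (n : ℕ) (hn : 0 < n) (Ω : Opens (Fin n → ℂ))
    (u : Koppelman.LSection n (-1) ((Koppelman.square Ω : Set (Koppelman.Pt n)) \ Koppelman.diagonal n))
    (hu : ∀ x ∈ (Koppelman.square Ω : Set (Koppelman.Pt n)) \ Koppelman.diagonal n,
      Koppelman.nablaEta u.toForm x = 1)
    (hgrowth : ∀ k : ℕ, 1 ≤ k → k ≤ n →
      ∀ K : Set (Koppelman.Pt n), IsCompact K → K ⊆ (Koppelman.square Ω : Set (Koppelman.Pt n)) →
        ∃ C : ℝ, ∀ x ∈ K \ Koppelman.diagonal n,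
          ‖u.comp k x‖ ≤ C * Koppelman.absEta x ^ (-(2 * (k : ℤ) - 1))) :
    LocallyIntegrableOn u.toForm (Koppelman.square Ω : Set (Koppelman.Pt n)) ∧
      (Koppelman.Current.ofForm (Koppelman.square Ω) u.toForm).nablaEta =
        Koppelman.Current.ofForm (Koppelman.square Ω) (fun _ => 1) - Koppelman.Current.diagonal Ω := by
  have hg := Koppelman.growthBound_of_absEta hgrowth
  exact ⟨Koppelman.locallyIntegrableOn_toForm hn hg, Koppelman.nablaEta_ofForm_toForm hn hu hg⟩
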